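/- Let $V$ be a complex vector space of finite dimension $n$. An element $t\in GL(V)$ is a reflection if its fixed space has dimension $n-1$, and a complex reflection group on $V$ is a finite subgroup $W\subseteq GL(V)$ generated by reflections; $V$ is then called its reflection representation and $n$ its rank. Such a group $W$ is irreducible if it cannot be written as a direct product $W_1\times W_2$ of complex reflection groups $W_1$ on $V_1$ and $W_2$ on $V_2$ acting on $V=V_1\oplus V_2$, unless $V_1=0$ or $V_2=0$. Let $W$ be an irreducible complex reflection group of rank $n$ with reflection representation $V$; if $n=1$, assume that $W$ is not the trivial group. Let $W$ act on $V^*$ by the dual action and on the exterior algebra $\wedge(V\oplus V^*)$ by algebra automorphisms, and give this algebra the bigrading in which $V$ has bidegree $(1,0)$ and $V^*$ has bidegree $(0,1)$. Let $$DR_W=\wedge(V\oplus V^*)/\langle \wedge(V\oplus V^*)^W_+\rangle$$ be the quotient by the two-sided ideal generated by the $W$-invariant elements with vanishing constant term, and let $(DR_W)_{i,j}$ be the image of the component $\wedge(V\oplus V^*)_{i,j}$ in $DR_W$, a $W$-module. The Grothendieck ring of $W$ is the ring generated by the symbols $[U]$, for $U$ a finite-dimensional complex $W$-module, subject to $[U]=[U']+[U'']$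 for every short exact sequence $0\to U'\to U\to U''\to 0$ and to $[U]\cdot[U']=[U\otimes U']$, with unit the class of the trivial module $\mathbb{C}$. Then for all integers $i,j\ge 0$: 1. if $i+j>n$, then $(DR_W)_{i,j}=0$; 2. if $i+j\le n$, then in the Grothendieck ring of $W$ $$[(DR_W)_{i,j}]=[\wedge^iV]\cdot[\wedge^jV^*]-[\wedge^{i-1}V]\cdot[\wedge^{j-1}V^*],$$ where $\wedge^{-1}V=\wedge^{-1}V^*=0$. -/

import Mathlib

noncomputable section

open Module Representation

namespace FermionicCoinvariants

/-! ### Complex reflection groups -/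

section ReflectionGroups

variable {V : Type} [AddCommGroup V] [Module ℂ V]

/-- `t ∈ GL(V)` is a reflection if its fixed space has dimension `dim V - 1`. -/
def IsReflection (t : LinearMap.GeneralLinearGroup ℂ V) : Prop :=
  finrank ℂ (LinearMap.eqLocus (t : V →ₗ[ℂ] V) LinearMap.id) + 1 = finrank ℂ V

/-- A complex reflection group is a finite subgroup of `GL(V)` generated by reflections. -/
structure IsComplexReflectionGroup (W : Subgroup (LinearMap.GeneralLinearGroup ℂ V)) : Prop where
  finite : Finite W
  generated : Subgroup.closure {t | t ∈ W ∧ IsReflection t} = W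

/-- `W`, acting on `V = V₁ ⊕ V₂`, is the direct product `W₁ × W₂`, where `W₁` acts on `V₁` and
`W₂` acts on `V₂`. -/
def IsDirectProduct (W : Subgroup (LinearMap.GeneralLinearGroup ℂ V)) (V₁ V₂ : Submodule ℂ V)
    (W₁ : Subgroup (LinearMap.GeneralLinearGroup ℂ V₁))
    (W₂ : Subgroup (LinearMap.GeneralLinearGroup ℂ V₂)) : Prop :=
  ∀ g : LinearMap.GeneralLinearGroup ℂ V, g ∈ W ↔ ∃ g₁ ∈ W₁, ∃ g₂ ∈ W₂,
    (∀ v : V₁, (g : V →ₗ[ℂ] V) v = (g₁ : V₁ →ₗ[ℂ] V₁) v) ∧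
    (∀ v : V₂, (g : V →ₗ[ℂ] V) v = (g₂ : V₂ →ₗ[ℂ] V₂) v)

/-- A reflection group `W` acting on `V` is irreducible if it is not a direct product `W₁ × W₂` of
reflection groups acting on `V = V₁ ⊕ V₂`, unless `V₁ = 0` or `V₂ = 0`. -/
def IsIrreducibleReflectionGroup (W : Subgroup (LinearMap.GeneralLinearGroup ℂ V)) : Prop :=
  ∀ (V₁ V₂ : Submodule ℂ V) (W₁ : Subgroup (LinearMap.GeneralLinearGroup ℂ V₁))
    (W₂ : Subgroup (LinearMap.GeneralLinearGroup ℂ V₂)), IsCompl V₁ V₂ →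
    IsComplexReflectionGroup W₁ → IsComplexReflectionGroup W₂ →
    IsDirectProduct W V₁ V₂ W₁ W₂ → V₁ = ⊥ ∨ V₂ = ⊥

/-- The reflection representation `V` of a subgroup `W` of `GL(V)`. -/
def reflectionRep (W : Subgroup (LinearMap.GeneralLinearGroup ℂ V)) : Representation ℂ W V :=
  (Units.coeHom (V →ₗ[ℂ] V)).comp W.subtype

end ReflectionGroups

/-! ### The Grothendieck ring -/

section Grothendieck

open scoped TensorProduct

variable (G : Type) [Group G]

/-- The defining relations of the Grothendieck ring, on the free commutative ring on the symbols
`[U]` with `U` a finite-dimensional complex `G`-module: `[U] = [U'] + [U'']` for every short exact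
sequence `0 → U' → U → U'' → 0`, `[U] * [U'] = [U ⊗ U']`, and `1 = [ℂ]` for the trivial
module `ℂ`. -/
inductive GrothendieckRel : MvPolynomial (FDRep ℂ G) ℤ → MvPolynomial (FDRep ℂ G) ℤ → Prop
  | exact {U' U U'' : Type} [AddCommGroup U'] [Module ℂ U'] [FiniteDimensional ℂ U']
      [AddCommGroup U] [Module ℂ U] [FiniteDimensional ℂ U]
      [AddCommGroup U''] [Module ℂ U''] [FiniteDimensional ℂ U'']
      (ρ' : Representation ℂ G U') (ρ : Representation ℂ G U) (ρ'' : Representation ℂ G U'')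
      (f : IntertwiningMap ρ' ρ) (g : IntertwiningMap ρ ρ'')
      (hf : Function.Injective f) (hfg : Function.Exact f g) (hg : Function.Surjective g) :
      GrothendieckRel (MvPolynomial.X (FDRep.of ρ))
        (MvPolynomial.X (FDRep.of ρ') + MvPolynomial.X (FDRep.of ρ''))
  | tensor {U U' : Type} [AddCommGroup U] [Module ℂ U] [FiniteDimensional ℂ U]
      [AddCommGroup U'] [Module ℂ U'] [FiniteDimensional ℂ U']
      (ρ : Representation ℂ G U) (ρ' : Representation ℂ G U') :
      GrothendieckRel (MvPolynomial.X (FDRep.of ρ) * MvPolynomial.X (FDRep.of ρ'))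
        (MvPolynomial.X (FDRep.of (ρ.tprod ρ')))
  | one : GrothendieckRel 1 (MvPolynomial.X (FDRep.of (Representation.trivial ℂ G ℂ)))

/-- The Grothendieck ring of finite-dimensional complex `G`-modules. -/
abbrev GrothendieckRing : Type 1 :=
  MvPolynomial (FDRep ℂ G) ℤ ⧸ Ideal.span {p | ∃ a b, GrothendieckRel G a b ∧ p = a - b}

variable {G}

/-- The class `[U]` of a finite-dimensional `G`-module `U` in the Grothendieck ring. -/
def repClass {U : Type} [AddCommGroup U] [Module ℂ U] [FiniteDimensional ℂ U]
    (ρ : Representation ℂ G U) : GrothendieckRing G :=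
  Ideal.Quotient.mk _ (MvPolynomial.X (FDRep.of ρ))

end Grothendieck

/-! ### Exterior powers, the exterior algebra and the coinvariant ring -/

section Exterior

variable {G : Type} [Group G] {V : Type} [AddCommGroup V] [Module ℂ V]

/-- The action of `G` on the exterior power `⋀^k V`. -/
def exteriorPowerRep (ρ : Representation ℂ G V) (k : ℕ) : Representation ℂ G (⋀[ℂ]^k V) where
  toFun g := exteriorPower.map k (ρ g)
  map_one' := by rw [map_one]; exact exteriorPower.map_id
  map_mul' g h := by rw [map_mul]; exact exteriorPower.map_comp _ _

/-- The class `[⋀^k V]` in the Grothendieck ring for an integer `k`, where `⋀^k V = 0` for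
negative `k`. -/
def exteriorPowerClass [FiniteDimensional ℂ V] (ρ : Representation ℂ G V) :
    ℤ → GrothendieckRing G
  | Int.ofNat k => repClass (exteriorPowerRep ρ k)
  | Int.negSucc _ => 0

variable (V) in
/-- The exterior algebra `⋀(V ⊕ V*)`. -/
abbrev FermionAlgebra : Type := ExteriorAlgebra ℂ (V × Dual ℂ V)

variable (V) in
/-- The bihomogeneous component `⋀(V ⊕ V*)_{i,j}`, spanned by the products of `i` vectors in `V` and
`j` vectors in `V*`. -/
def bidegree (i j : ℕ) : Submodule ℂ (FermionAlgebra V) :=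
  LinearMap.range (ExteriorAlgebra.ι ℂ ∘ₗ LinearMap.inl ℂ V (Dual ℂ V)) ^ i *
    LinearMap.range (ExteriorAlgebra.ι ℂ ∘ₗ LinearMap.inr ℂ V (Dual ℂ V)) ^ j

/-- `g ∈ G` acts on `⋀(V ⊕ V*)` by the algebra map extending its action on `V ⊕ V*`. -/
def fermionMap (ρ : Representation ℂ G V) (g : G) : FermionAlgebra V →ₐ[ℂ] FermionAlgebra V :=
  ExteriorAlgebra.map ((ρ.prod ρ.dual) g)

/-- The two-sided ideal of `⋀(V ⊕ V*)` generated by the `G`-invariant elements with vanishing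
constant term. -/
def coinvariantIdeal (ρ : Representation ℂ G V) : Ideal (FermionAlgebra V) :=
  (TwoSidedIdeal.span {x : FermionAlgebra V |
    (∀ g, fermionMap ρ g x = x) ∧ ExteriorAlgebra.algebraMapInv x = 0}).asIdeal

instance (ρ : Representation ℂ G V) : (coinvariantIdeal ρ).IsTwoSided := by
  unfold coinvariantIdeal; infer_instance

/-- The fermionic diagonal coinvariant ring `DR_G`. -/
abbrev DR (ρ : Representation ℂ G V) : Type := FermionAlgebra V ⧸ coinvariantIdeal ρ

theorem coinvariantIdeal_le_comap (ρ : Representation ℂ G V) (g : G) :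
    coinvariantIdeal ρ ≤ (coinvariantIdeal ρ).comap (fermionMap ρ g) := by
  intro x hx
  have h : TwoSidedIdeal.span {x : FermionAlgebra V |
      (∀ g, fermionMap ρ g x = x) ∧ ExteriorAlgebra.algebraMapInv x = 0} ≤
      (TwoSidedIdeal.span {x : FermionAlgebra V |
      (∀ g, fermionMap ρ g x = x) ∧ ExteriorAlgebra.algebraMapInv x = 0}).comap
        (fermionMap ρ g) := by
    rw [TwoSidedIdeal.span_le]
    intro y hy
    rw [SetLike.mem_coe, TwoSidedIdeal.mem_comap, hy.1 g]
    exact TwoSidedIdeal.subset_span hy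
  exact TwoSidedIdeal.mem_asIdeal.2 ((TwoSidedIdeal.mem_comap _).1
    (h (TwoSidedIdeal.mem_asIdeal.1 hx)))

/-- The action of `G` on `DR_G` induced by its action on `⋀(V ⊕ V*)`. -/
def DRRep (ρ : Representation ℂ G V) : Representation ℂ G (DR ρ) where
  toFun g := (Ideal.quotientMapₐ (coinvariantIdeal ρ) (fermionMap ρ g)
    (coinvariantIdeal_le_comap ρ g)).toLinearMap
  map_one' := by
    refine LinearMap.ext fun x ↦ ?_
    obtain ⟨x, rfl⟩ := Ideal.Quotient.mk_surjective x
    have h : fermionMap ρ 1 = AlgHom.id ℂ _ := by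
      rw [fermionMap, map_one]; exact ExteriorAlgebra.map_id
    exact congrArg (Ideal.Quotient.mk (coinvariantIdeal ρ)) (DFunLike.congr_fun h x)
  map_mul' g h := by
    refine LinearMap.ext fun x ↦ ?_
    obtain ⟨x, rfl⟩ := Ideal.Quotient.mk_surjective x
    have h : fermionMap ρ (g * h) = (fermionMap ρ g).comp (fermionMap ρ h) := by
      rw [fermionMap, map_mul]; exact (ExteriorAlgebra.map_comp_map _ _).symm
    exact congrArg (Ideal.Quotient.mk (coinvariantIdeal ρ)) (DFunLike.congr_fun h x)

/-- The bihomogeneous component `(DR_G)_{i,j}`, the image of `⋀(V ⊕ V*)_{i,j}`. -/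
def DRBidegree (ρ : Representation ℂ G V) (i j : ℕ) : Submodule ℂ (DR ρ) :=
  (bidegree V i j).map (Ideal.Quotient.mkₐ ℂ (coinvariantIdeal ρ)).toLinearMap

theorem bidegree_map_le (ρ : Representation ℂ G V) (i j : ℕ) (g : G) :
    (bidegree V i j).map (fermionMap ρ g).toLinearMap ≤ bidegree V i j := by
  unfold bidegree
  rw [Submodule.map_mul, Submodule.map_pow, Submodule.map_pow]
  refine mul_le_mul' (pow_le_pow_left' ?_ i) (pow_le_pow_left' ?_ j)
  · rintro _ ⟨_, ⟨v, rfl⟩, rfl⟩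
    exact ⟨ρ g v, by simp [fermionMap]⟩
  · rintro _ ⟨_, ⟨v, rfl⟩, rfl⟩
    exact ⟨ρ.dual g v, by simp [fermionMap]⟩

theorem DRBidegree_le_comap (ρ : Representation ℂ G V) (i j : ℕ) (g : G) :
    DRBidegree ρ i j ≤ (DRBidegree ρ i j).comap (DRRep ρ g) := by
  rintro _ ⟨x, hx, rfl⟩
  exact ⟨fermionMap ρ g x, bidegree_map_le ρ i j g ⟨x, hx, rfl⟩, rfl⟩

instance [FiniteDimensional ℂ V] (ρ : Representation ℂ G V) (i j : ℕ) :
    FiniteDimensional ℂ (DRBidegree ρ i j) := by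
  rw [FiniteDimensional, Module.Finite.iff_fg]
  refine Submodule.FG.map _ (Submodule.FG.mul (Submodule.FG.pow ?_ i) (Submodule.FG.pow ?_ j)) <;>
  · rw [LinearMap.range_eq_map]
    exact Submodule.FG.map _ Module.Finite.fg_top

/-- The action of `G` on `(DR_G)_{i,j}`. -/
def DRBidegreeRep (ρ : Representation ℂ G V) (i j : ℕ) :
    Representation ℂ G (DRBidegree ρ i j) :=
  (DRRep ρ).subrepresentation (DRBidegree ρ i j) (DRBidegree_le_comap ρ i j)

end Exterior

end FermionicCoinvariants

end

/-! Every `W`-invariant of `⋀(V ⊕ V*)` is already an invariant of `𝔤𝔩(V)`. A reflection of finite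
order is `id + (ζ - 1) α ⊗ a` with `α a = 1`, and an element that it fixes is killed by the
derivation attached to the rank one operator `a ⊗ α` (`rankOneAction_eq_zero_of_fixed`). The
operators killing a given invariant form a Lie algebra containing these elements, and the bracket
argument `rankOneAction_eq_zero_of_bracket` together with irreducibility of `V` spreads this to all
rank one operators (`rankOneAction_eq_zero_of_invariant`). That `V` is an irreducible module follows
from the definition through direct products: an invariant subspace has an invariant complement, and
every reflection acts trivially on one of the two summands.

Let `L` be multiplication by the canonical element of `V ⊗ V*`, let `Λ` be the dual contraction, and
let `n = dim V`. Summing the relations `(a ⊗ α) x = 0` over a basis gives `i (n + 1 - i) x = L (Λ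
x)` for a `𝔤𝔩(V)`-invariant `x` of bidegree `(i, i)`. An invariant of bidegree `(i, j)` with `i ≠ j`
is zero, because the identity of `V` acts on it by `i - j`. Hence invariants without constant term
are multiples of the canonical element, which is itself invariant and central, so the coinvariant
ideal is the image of `L` (`mem_coinvariantIdeal_iff`).

Finally `L`, `Λ` and `n - i - j` form an `𝔰𝔩₂`-triple. By hard Lefschetz, `L` is injective on
bidegree `(i, j)` if `i + j < n`, and every element of bidegree `(i, j)` with `i + j > n` lies in
its image. The latter is the vanishing statement. The former gives exact sequences with the
component of bidegree `(i, j)`, that of bidegree `(i + 1, j + 1)`, and its quotient in `DR_W`. Since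
these components are `⋀^i V ⊗ ⋀^j V*`, the formula for the classes follows. -/

noncomputable section

open Module Representation

namespace FermionicCoinvariants

/-! ### Contractions on an exterior algebra -/

section Contraction

variable {R M : Type*} [CommRing R] [AddCommGroup M] [Module R M]

/-- Contraction of the exterior algebra with a linear form. -/
def contract (d : Dual R M) : ExteriorAlgebra R M →ₗ[R] ExteriorAlgebra R M :=
  CliffordAlgebra.contractLeft (Q := (0 : QuadraticForm R M)) d

theorem contract_ι_mul (d : Dual R M) (u : M) (x : ExteriorAlgebra R M) :
    contract d (ExteriorAlgebra.ι R u * x) = d u • x - ExteriorAlgebra.ι R u * contract d x :=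
  CliffordAlgebra.contractLeft_ι_mul _ _ _

theorem contract_contract_comm (d e : Dual R M) (x : ExteriorAlgebra R M) :
    contract d (contract e x) = -contract e (contract d x) :=
  CliffordAlgebra.contractLeft_comm _ _ _

theorem contract_algebraMap (d : Dual R M) (r : R) :
    contract d (algebraMap R (ExteriorAlgebra R M) r) = 0 :=
  CliffordAlgebra.contractLeft_algebraMap _ _ _

theorem contract_one (d : Dual R M) : contract d 1 = 0 :=
  CliffordAlgebra.contractLeft_one _ _

theorem contract_add (d e : Dual R M) (x : ExteriorAlgebra R M) :
    contract (d + e) x = contract d x + contract e x := by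
  simp [contract]

theorem contract_smul (r : R) (d : Dual R M) (x : ExteriorAlgebra R M) :
    contract (r • d) x = r • contract d x := by
  simp [contract]

theorem ι_mul_ι_mul_comm (u v : M) (x : ExteriorAlgebra R M) :
    ExteriorAlgebra.ι R u * (ExteriorAlgebra.ι R v * x) =
      -(ExteriorAlgebra.ι R v * (ExteriorAlgebra.ι R u * x)) := by
  rw [← mul_assoc, ← mul_assoc, eq_neg_of_add_eq_zero_left (ExteriorAlgebra.ι_add_mul_swap u v),
    neg_mul]

theorem ι_mul_ι_mul_self (u : M) (x : ExteriorAlgebra R M) :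
    ExteriorAlgebra.ι R u * (ExteriorAlgebra.ι R u * x) = 0 := by
  rw [← mul_assoc, ExteriorAlgebra.ι_sq_zero, zero_mul]

/-- The algebra automorphism induced by a rank one perturbation of the identity. -/
theorem map_id_add_smulRight (d : Dual R M) (u : M) (x : ExteriorAlgebra R M) :
    ExteriorAlgebra.map (LinearMap.id + d.smulRight u) x =
      x + ExteriorAlgebra.ι R u * contract d x := by
  induction x using CliffordAlgebra.left_induction with
  | algebraMap r =>
    have h := contract_algebraMap d r
    rw [show (algebraMap R (CliffordAlgebra (0 : QuadraticForm R M))) r =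
      algebraMap R (ExteriorAlgebra R M) r from rfl, h, AlgHom.commutes]
    simp
  | add x y hx hy => rw [map_add, map_add, hx, hy, mul_add]; abel
  | ι_mul x m hx =>
    change ExteriorAlgebra.map _ (ExteriorAlgebra.ι R m * x) = ExteriorAlgebra.ι R m * x +
      ExteriorAlgebra.ι R u * contract d (ExteriorAlgebra.ι R m * x)
    -- The product is `(m + d(m) u)(x + u (d ⌟ x))`. Its quadratic term contains `u` twice and
    -- vanishes, so the first order expansion is exact.
    rw [map_mul, hx, ExteriorAlgebra.map_apply_ι, contract_ι_mul]
    simp only [LinearMap.add_apply, LinearMap.id_apply, LinearMap.smulRight_apply, map_add,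
      map_smul, add_mul, mul_add, mul_sub, smul_mul_assoc, mul_smul_comm, ι_mul_ι_mul_self,
      smul_zero, add_zero]
    rw [ι_mul_ι_mul_comm u m]
    abel

end Contraction

/-! ### Creation and annihilation operators on `⋀(V ⊕ V*)` -/

section Fermion

variable {V : Type} [AddCommGroup V] [Module ℂ V]

variable (V) in
/-- The inclusion of `V` into `⋀(V ⊕ V*)`. -/
def ιV : V →ₗ[ℂ] FermionAlgebra V := ExteriorAlgebra.ι ℂ ∘ₗ LinearMap.inl ℂ V (Dual ℂ V)

variable (V) in
/-- The inclusion of `V*` into `⋀(V ⊕ V*)`. -/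
def ιD : Dual ℂ V →ₗ[ℂ] FermionAlgebra V := ExteriorAlgebra.ι ℂ ∘ₗ LinearMap.inr ℂ V (Dual ℂ V)

/-- Contraction with a linear form on `V`, vanishing on `V*`. -/
def contractV (α : Dual ℂ V) : FermionAlgebra V →ₗ[ℂ] FermionAlgebra V :=
  contract (α ∘ₗ LinearMap.fst ℂ V (Dual ℂ V))

/-- Contraction with a vector of `V`, viewed as a linear form on `V*`, vanishing on `V`. -/
def contractD (a : V) : FermionAlgebra V →ₗ[ℂ] FermionAlgebra V :=
  contract (Dual.eval ℂ V a ∘ₗ LinearMap.snd ℂ V (Dual ℂ V))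

theorem contractV_ιV_mul (α : Dual ℂ V) (v : V) (x : FermionAlgebra V) :
    contractV α (ιV V v * x) = α v • x - ιV V v * contractV α x := by
  simp [contractV, ιV, contract_ι_mul]

theorem contractV_ιD_mul (α f : Dual ℂ V) (x : FermionAlgebra V) :
    contractV α (ιD V f * x) = -(ιD V f * contractV α x) := by
  simp [contractV, ιD, contract_ι_mul]

theorem contractD_ιV_mul (a v : V) (x : FermionAlgebra V) :
    contractD a (ιV V v * x) = -(ιV V v * contractD a x) := by
  simp [contractD, ιV, contract_ι_mul]

theorem contractD_ιD_mul (a : V) (f : Dual ℂ V) (x : FermionAlgebra V) :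
    contractD a (ιD V f * x) = f a • x - ιD V f * contractD a x := by
  simp [contractD, ιD, contract_ι_mul]

theorem contractD_contractV (a : V) (α : Dual ℂ V) (x : FermionAlgebra V) :
    contractD a (contractV α x) = -contractV α (contractD a x) :=
  contract_contract_comm _ _ _

theorem contractV_comm (α β : Dual ℂ V) (x : FermionAlgebra V) :
    contractV α (contractV β x) = -contractV β (contractV α x) :=
  contract_contract_comm _ _ _

theorem contractD_comm (a b : V) (x : FermionAlgebra V) :
    contractD a (contractD b x) = -contractD b (contractD a x) :=
  contract_contract_comm _ _ _

theorem ιD_mul_ιV_mul (f : Dual ℂ V) (v : V) (x : FermionAlgebra V) :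
    ιD V f * (ιV V v * x) = -(ιV V v * (ιD V f * x)) :=
  ι_mul_ι_mul_comm _ _ _

theorem ιV_mul_comm (v w : V) (x : FermionAlgebra V) :
    ιV V v * (ιV V w * x) = -(ιV V w * (ιV V v * x)) :=
  ι_mul_ι_mul_comm _ _ _

theorem ιD_mul_comm (f g : Dual ℂ V) (x : FermionAlgebra V) :
    ιD V f * (ιD V g * x) = -(ιD V g * (ιD V f * x)) :=
  ι_mul_ι_mul_comm _ _ _

theorem ιV_mul_self (v : V) (x : FermionAlgebra V) : ιV V v * (ιV V v * x) = 0 :=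
  ι_mul_ι_mul_self _ _

/-- The action on `⋀(V ⊕ V*)` of the rank one element `a ⊗ α` of `𝔤𝔩(V)` by derivations. -/
def rankOneAction (a : V) (α : Dual ℂ V) (x : FermionAlgebra V) : FermionAlgebra V :=
  ιV V a * contractV α x - ιD V α * contractD a x

theorem rankOneAction_add_left (a b : V) (α : Dual ℂ V) (x : FermionAlgebra V) :
    rankOneAction (a + b) α x = rankOneAction a α x + rankOneAction b α x := by
  simp only [rankOneAction, contractD, map_add, LinearMap.add_comp, contract_add, add_mul, mul_add]
  abel

theorem rankOneAction_smul_left (c : ℂ) (a : V) (α : Dual ℂ V) (x : FermionAlgebra V) :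
    rankOneAction (c • a) α x = c • rankOneAction a α x := by
  simp only [rankOneAction, contractD, map_smul, LinearMap.smul_comp, contract_smul,
    smul_mul_assoc, mul_smul_comm, smul_sub]

theorem rankOneAction_add_right (a : V) (α β : Dual ℂ V) (x : FermionAlgebra V) :
    rankOneAction a (α + β) x = rankOneAction a α x + rankOneAction a β x := by
  simp only [rankOneAction, contractV, map_add, LinearMap.add_comp, contract_add, add_mul, mul_add]
  abel

theorem rankOneAction_smul_right (c : ℂ) (a : V) (α : Dual ℂ V) (x : FermionAlgebra V) :
    rankOneAction a (c • α) x = c • rankOneAction a α x := by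
  simp only [rankOneAction, contractV, map_smul, LinearMap.smul_comp, contract_smul,
    smul_mul_assoc, mul_smul_comm, smul_sub]

theorem rankOneAction_add (a : V) (α : Dual ℂ V) (x y : FermionAlgebra V) :
    rankOneAction a α (x + y) = rankOneAction a α x + rankOneAction a α y := by
  simp only [rankOneAction, map_add, mul_add]
  abel

theorem rankOneAction_smul (a : V) (α : Dual ℂ V) (c : ℂ) (x : FermionAlgebra V) :
    rankOneAction a α (c • x) = c • rankOneAction a α x := by
  simp only [rankOneAction, map_smul, mul_smul_comm, smul_sub]

/-- This is the commutator of rank one operators in `𝔤𝔩(V)`. After expansion by the anticommutation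
relations the quartic terms cancel, and so do the mixed ones between `V` and `V*`. -/
theorem rankOneAction_bracket (a b : V) (α β : Dual ℂ V) (x : FermionAlgebra V) :
    rankOneAction a α (rankOneAction b β x) - rankOneAction b β (rankOneAction a α x) =
      α b • rankOneAction a β x - β a • rankOneAction b α x := by
  simp only [rankOneAction, map_sub, contractV_ιV_mul, contractV_ιD_mul, contractD_ιV_mul,
    contractD_ιD_mul, mul_sub, mul_smul_comm, smul_sub, mul_neg, contractD_contractV]
  rw [contractV_comm β α, contractD_comm b a, ιV_mul_comm b a, ιD_mul_comm β α,
    ιD_mul_ιV_mul β a, ιD_mul_ιV_mul α b]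
  simp only [mul_neg]
  abel

/-- If `b ⊗ β` and `v ⊗ α` annihilate `x`, then so does `β(v) b ⊗ α`. -/
theorem rankOneAction_eq_zero_of_bracket {b v : V} {α β : Dual ℂ V} {x : FermionAlgebra V}
    (hb : β b = 1) (h₁ : rankOneAction b β x = 0) (h₂ : rankOneAction v α x = 0) :
    rankOneAction (β v • b) α x = 0 := by
  have h0 (a : V) (γ : Dual ℂ V) : rankOneAction a γ (0 : FermionAlgebra V) = 0 := by
    simp [rankOneAction]
  have e₁ := rankOneAction_bracket b v β α x
  rw [h₁, h₂, h0, h0, sub_zero] at e₁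
  -- On `x`, the operators `b ⊗ α` and `v ⊗ β` give vectors on which `b ⊗ β` acts by `1` and `-1`.
  -- So applying `b ⊗ β` to the relation `e₁` between them flips one sign, and adding the two
  -- relations leaves twice one term.
  have e₂ := congrArg (rankOneAction b β) e₁
  have e₃ := rankOneAction_bracket b b β α x
  have e₄ := rankOneAction_bracket b v β β x
  rw [h₁, h0, sub_zero, hb, one_smul, smul_zero, sub_zero] at e₃
  rw [h₁, h0, sub_zero, hb, one_smul, smul_zero, zero_sub] at e₄
  rw [sub_eq_add_neg, rankOneAction_add, ← neg_smul, rankOneAction_smul, rankOneAction_smul, h0,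
    e₃, e₄, neg_smul, smul_neg, neg_neg] at e₂
  have e₅ : β v • rankOneAction b α x = α b • rankOneAction v β x := (sub_eq_zero.1 e₁.symm)
  rw [← e₅, ← two_smul ℂ] at e₂
  rw [rankOneAction_smul_left]
  exact (smul_eq_zero.1 e₂.symm).resolve_left two_ne_zero

end Fermion

/-! ### Reflections and rank one operators -/

section Reflection

variable {V : Type} [AddCommGroup V] [Module ℂ V]

/-- An element of `⋀(V ⊕ V*)` fixed by the reflection `v ↦ v + (ζ - 1) α(v) a` is annihilated by
the action of `a ⊗ α ∈ 𝔤𝔩(V)`. -/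
theorem rankOneAction_eq_zero_of_fixed {a : V} {α : Dual ℂ V} {ζ : ℂ} (haα : α a = 1)
    (hζ : ζ ≠ 0) (hζ1 : ζ ≠ 1) {S : V × Dual ℂ V →ₗ[ℂ] V × Dual ℂ V}
    (hS : ∀ v f, S (v, f) = (v + ((ζ - 1) * α v) • a, f + ((ζ⁻¹ - 1) * f a) • α))
    {x : FermionAlgebra V} (hx : ExteriorAlgebra.map S x = x) : rankOneAction a α x = 0 := by
  set k := ζ - 1 with hk
  set k' := ζ⁻¹ - 1 with hk'
  -- The two rank one perturbations act on `V` and on `V*` separately, and each induces a map given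
  -- by the first order formula.
  have hS' : S = (LinearMap.id + (k • (α ∘ₗ LinearMap.fst ℂ V (Dual ℂ V))).smulRight (a, 0)) ∘ₗ
      (LinearMap.id + (k' • (Dual.eval ℂ V a ∘ₗ LinearMap.snd ℂ V (Dual ℂ V))).smulRight (0, α)) := by
    refine LinearMap.ext fun ⟨v, f⟩ ↦ ?_
    rw [hS]
    simp [mul_smul]
  rw [hS', ← ExteriorAlgebra.map_comp_map, AlgHom.comp_apply, map_id_add_smulRight,
    map_id_add_smulRight, contract_smul, contract_smul] at hx
  change x + ιD V α * (k' • contractD a x) + ιV V a *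
    (k • contractV α (x + ιD V α * (k' • contractD a x))) = x at hx
  set P : FermionAlgebra V → FermionAlgebra V := fun y ↦ ιV V a * contractV α y with hP
  set Q := ιD V α * contractD a x with hQ
  have hx1 : k' • Q + k • P x + (k * k') • P Q = 0 := by
    have : x + (k' • Q + k • P x + (k * k') • P Q) = x := by
      refine Eq.trans ?_ hx
      simp only [hP, hQ, mul_smul_comm, map_add, map_smul, smul_add, mul_add, smul_smul]
      abel
    simpa using this
  have hPP (y : FermionAlgebra V) : P (P y) = P y := by
    simp only [hP, contractV_ιV_mul, mul_sub, haα, one_smul, ιV_mul_self, sub_zero]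
  have hPadd (y z : FermionAlgebra V) : P (y + z) = P y + P z := by simp [hP, mul_add]
  have hPsmul (c : ℂ) (y : FermionAlgebra V) : P (c • y) = c • P y := by simp [hP]
  have hkk : k ≠ 0 := sub_ne_zero.2 hζ1
  -- This is `(1 + k) (1 + k') = ζ ζ⁻¹ = 1`.
  have hkk' : k' + k + k * k' = 0 := by rw [hk, hk']; field_simp; ring
  have hk'0 : k' ≠ 0 := fun h ↦ hkk (by simpa [h] using hkk')
  -- Applying the idempotent `P` to `hx1` and replacing `k' + k k'` by `-k` gives `k (P x - P Q) =
  -- 0`. Inserting this into `hx1` then yields `k' (Q - P x) = 0`.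
  have e₁ : P x = P Q := by
    have h := congrArg P hx1
    rw [hPadd, hPadd, hPsmul, hPsmul, hPsmul, hPP, hPP] at h
    have h0 : P 0 = 0 := by simp [hP]
    have h2 : k • (P x - P Q) = 0 := by
      rw [smul_sub, sub_eq_zero]
      have : k' • P Q + k • P x + (k * k') • P Q - (k' + k + k * k') • P Q = 0 := by
        rw [h, h0, hkk', zero_smul, sub_zero]
      rw [add_smul, add_smul] at this
      rw [← sub_eq_zero, ← this]
      abel
    exact sub_eq_zero.1 ((smul_eq_zero.1 h2).resolve_left hkk)
  have e₂ : k' • (Q - P x) = 0 := by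
    rw [← e₁] at hx1
    have : k' • Q + k • P x + (k * k') • P x - (k' + k + k * k') • P x = 0 := by
      rw [hx1, hkk', zero_smul, sub_zero]
    rw [add_smul, add_smul] at this
    rw [← this, smul_sub]
    abel
  rw [smul_eq_zero, or_iff_right hk'0, sub_eq_zero] at e₂
  exact sub_eq_zero.2 e₂.symm

end Reflection

/-! ### The Lefschetz element -/

section Lefschetz

variable {V : Type} [AddCommGroup V] [Module ℂ V] {κ : Type} [Fintype κ] (b : Basis κ ℂ V)

/-- The canonical element of `V ⊗ V*`, in `⋀(V ⊕ V*)`. -/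
def lefschetz : FermionAlgebra V := ∑ j, ιV V (b j) * ιD V (b.coord j)

/-- The operator dual to the multiplication by the Lefschetz element. -/
def dualLefschetz : FermionAlgebra V →ₗ[ℂ] FermionAlgebra V :=
  ∑ j, contractD (b j) ∘ₗ contractV (b.coord j)

/-- The operator multiplying an element of bidegree `(i, j)` with `i`. -/
def degreeV : FermionAlgebra V →ₗ[ℂ] FermionAlgebra V :=
  ∑ j, LinearMap.mulLeft ℂ (ιV V (b j)) ∘ₗ contractV (b.coord j)

/-- The operator multiplying an element of bidegree `(i, j)` with `j`. -/
def degreeD : FermionAlgebra V →ₗ[ℂ] FermionAlgebra V :=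
  ∑ j, LinearMap.mulLeft ℂ (ιD V (b.coord j)) ∘ₗ contractD (b j)

theorem lefschetz_mul (x : FermionAlgebra V) :
    lefschetz b * x = ∑ j, ιV V (b j) * (ιD V (b.coord j) * x) := by
  simp [lefschetz, Finset.sum_mul, mul_assoc]

theorem dualLefschetz_apply (x : FermionAlgebra V) :
    dualLefschetz b x = ∑ j, contractD (b j) (contractV (b.coord j) x) := by
  simp [dualLefschetz]

theorem degreeV_apply (x : FermionAlgebra V) :
    degreeV b x = ∑ j, ιV V (b j) * contractV (b.coord j) x := by
  simp [degreeV]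

theorem degreeD_apply (x : FermionAlgebra V) :
    degreeD b x = ∑ j, ιD V (b.coord j) * contractD (b j) x := by
  simp [degreeD]

theorem sum_apply_smul_coord (f : Dual ℂ V) : ∑ j, f (b j) • b.coord j = f := by
  refine b.ext fun i ↦ ?_
  simp

theorem sum_coord_smul (v : V) : ∑ j, b.coord j v • b j = v := by
  simp [b.sum_repr]

/-- Contraction is an odd derivation and the canonical element is even, so no sign appears in the
second term. Contracting the canonical element itself with `α` returns `α`. -/
theorem contractV_lefschetz_mul (α : Dual ℂ V) (x : FermionAlgebra V) :
    contractV α (lefschetz b * x) = ιD V α * x + lefschetz b * contractV α x := by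
  simp only [lefschetz_mul, map_sum, contractV_ιV_mul, contractV_ιD_mul, mul_neg, sub_neg_eq_add,
    Finset.sum_add_distrib]
  congr 1
  conv_rhs => rw [← sum_apply_smul_coord b α, map_sum, Finset.sum_mul]
  simp

/-- The minus sign comes from moving the contraction past the factor in `V` before it meets the
factor in `V*`. -/
theorem contractD_lefschetz_mul (a : V) (x : FermionAlgebra V) :
    contractD a (lefschetz b * x) = -(ιV V a * x) + lefschetz b * contractD a x := by
  simp only [lefschetz_mul, map_sum, contractD_ιV_mul, contractD_ιD_mul, mul_sub, neg_sub,
    Finset.sum_sub_distrib, mul_smul_comm]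
  conv_rhs => rw [← sum_coord_smul b a, map_sum, Finset.sum_mul]
  simp [sub_eq_add_neg, add_comm]

theorem sum_contractD_ιD_mul (x : FermionAlgebra V) :
    ∑ j, contractD (b j) (ιD V (b.coord j) * x) = (Fintype.card κ : ℂ) • x - degreeD b x := by
  simp [contractD_ιD_mul, degreeD_apply, Finset.sum_sub_distrib, Nat.cast_smul_eq_nsmul]

theorem sum_contractV_ιV_mul (x : FermionAlgebra V) :
    ∑ j, contractV (b.coord j) (ιV V (b j) * x) = (Fintype.card κ : ℂ) • x - degreeV b x := by
  simp [contractV_ιV_mul, degreeV_apply, Finset.sum_sub_distrib, Nat.cast_smul_eq_nsmul]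

/-- The relation `[Λ, L] = H` of the `𝔰𝔩₂`-triple, with `H` equal to `n - i - j` on bidegree `(i,
j)`. -/
theorem dualLefschetz_lefschetz_mul (x : FermionAlgebra V) :
    dualLefschetz b (lefschetz b * x) - lefschetz b * dualLefschetz b x =
      (Fintype.card κ : ℂ) • x - degreeV b x - degreeD b x := by
  rw [dualLefschetz_apply, dualLefschetz_apply, sub_right_comm, ← sum_contractD_ιD_mul b]
  simp only [contractV_lefschetz_mul, map_add, contractD_lefschetz_mul, Finset.sum_add_distrib,
    Finset.mul_sum, degreeV_apply, Finset.sum_neg_distrib]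
  abel

/-! ### Commutation relations of the degree operators. -/

theorem degreeV_ιV_mul (v : V) (x : FermionAlgebra V) :
    degreeV b (ιV V v * x) = ιV V v * x + ιV V v * degreeV b x := by
  simp only [degreeV_apply, contractV_ιV_mul, mul_sub, Finset.sum_sub_distrib, mul_smul_comm,
    Finset.mul_sum]
  simp only [ιV_mul_comm _ v, Finset.sum_neg_distrib, sub_neg_eq_add]
  congr 1
  conv_rhs => rw [← sum_coord_smul b v, map_sum, Finset.sum_mul]
  simp

theorem degreeV_ιD_mul (f : Dual ℂ V) (x : FermionAlgebra V) :
    degreeV b (ιD V f * x) = ιD V f * degreeV b x := by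
  simp [degreeV_apply, contractV_ιD_mul, Finset.mul_sum, ιD_mul_ιV_mul]

theorem degreeD_ιD_mul (f : Dual ℂ V) (x : FermionAlgebra V) :
    degreeD b (ιD V f * x) = ιD V f * x + ιD V f * degreeD b x := by
  simp only [degreeD_apply, contractD_ιD_mul, mul_sub, Finset.sum_sub_distrib, mul_smul_comm,
    Finset.mul_sum]
  simp only [ιD_mul_comm _ f, Finset.sum_neg_distrib, sub_neg_eq_add]
  congr 1
  conv_rhs => rw [← sum_apply_smul_coord b f, map_sum, Finset.sum_mul]
  simp

theorem degreeD_ιV_mul (v : V) (x : FermionAlgebra V) :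
    degreeD b (ιV V v * x) = ιV V v * degreeD b x := by
  simp [degreeD_apply, contractD_ιV_mul, Finset.mul_sum, ιD_mul_ιV_mul]

theorem degreeV_one : degreeV b 1 = 0 := by
  simp [degreeV_apply, contractV, contract_one]

theorem degreeD_one : degreeD b 1 = 0 := by
  simp [degreeD_apply, contractD, contract_one]

theorem degreeV_lefschetz_mul (x : FermionAlgebra V) :
    degreeV b (lefschetz b * x) = lefschetz b * x + lefschetz b * degreeV b x := by
  simp only [lefschetz_mul, map_sum, degreeV_ιV_mul, degreeV_ιD_mul, Finset.sum_add_distrib]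

theorem degreeD_lefschetz_mul (x : FermionAlgebra V) :
    degreeD b (lefschetz b * x) = lefschetz b * x + lefschetz b * degreeD b x := by
  simp only [lefschetz_mul, map_sum, degreeD_ιD_mul, degreeD_ιV_mul, Finset.sum_add_distrib,
    mul_add]

theorem lefschetz_mul_ιV_mul (v : V) (x : FermionAlgebra V) :
    lefschetz b * (ιV V v * x) = ιV V v * (lefschetz b * x) := by
  simp only [lefschetz_mul, Finset.mul_sum, ιD_mul_ιV_mul, mul_neg]
  refine Finset.sum_congr rfl fun j _ ↦ ?_
  rw [ιV_mul_comm, neg_neg]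

theorem lefschetz_mul_ιD_mul (f : Dual ℂ V) (x : FermionAlgebra V) :
    lefschetz b * (ιD V f * x) = ιD V f * (lefschetz b * x) := by
  simp only [lefschetz_mul, Finset.mul_sum, ιD_mul_ιV_mul f]
  refine Finset.sum_congr rfl fun j _ ↦ ?_
  rw [ιD_mul_comm, mul_neg]

theorem sum_smul_contractV (α : Dual ℂ V) (x : FermionAlgebra V) :
    ∑ j, α (b j) • contractV (b.coord j) x = contractV α x := by
  let φ : Dual ℂ V →ₗ[ℂ] FermionAlgebra V := IsLinearMap.mk' (fun β ↦ contractV β x)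
    ⟨fun β γ ↦ by rw [contractV, LinearMap.add_comp, contract_add, ← contractV, ← contractV],
      fun c β ↦ by rw [contractV, LinearMap.smul_comp, contract_smul, ← contractV]⟩
  change ∑ j, α (b j) • φ (b.coord j) = φ α
  conv_rhs => rw [← sum_apply_smul_coord b α, map_sum]
  simp

theorem sum_smul_contractD (a : V) (x : FermionAlgebra V) :
    ∑ j, b.coord j a • contractD (b j) x = contractD a x := by
  let φ : V →ₗ[ℂ] FermionAlgebra V := IsLinearMap.mk' (fun v ↦ contractD v x)
    ⟨fun v w ↦ by
        rw [contractD, map_add, LinearMap.add_comp, contract_add, ← contractD, ← contractD],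
      fun c v ↦ by rw [contractD, map_smul, LinearMap.smul_comp, contract_smul, ← contractD]⟩
  change ∑ j, b.coord j a • φ (b j) = φ a
  conv_rhs => rw [← sum_coord_smul b a, map_sum]
  simp

theorem degreeV_contractV (α : Dual ℂ V) (x : FermionAlgebra V) :
    degreeV b (contractV α x) = contractV α (degreeV b x) - contractV α x := by
  simp only [degreeV_apply, map_sum, contractV_ιV_mul, Finset.sum_sub_distrib]
  rw [sum_smul_contractV]
  simp only [contractV_comm α, mul_neg, Finset.sum_neg_distrib]
  abel

theorem degreeD_contractD (a : V) (x : FermionAlgebra V) :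
    degreeD b (contractD a x) = contractD a (degreeD b x) - contractD a x := by
  simp only [degreeD_apply, map_sum, contractD_ιD_mul, Finset.sum_sub_distrib]
  have := sum_smul_contractD b a x
  simp only [Basis.coord_apply] at this ⊢
  rw [this]
  simp only [contractD_comm a, mul_neg, Finset.sum_neg_distrib]
  abel

theorem degreeV_contractD (a : V) (x : FermionAlgebra V) :
    degreeV b (contractD a x) = contractD a (degreeV b x) := by
  simp [degreeV_apply, contractD_ιV_mul, contractD_contractV]

theorem degreeD_contractV (α : Dual ℂ V) (x : FermionAlgebra V) :
    degreeD b (contractV α x) = contractV α (degreeD b x) := by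
  simp [degreeD_apply, contractV_ιD_mul, contractD_contractV]

/-- Elements annihilated by all of `𝔤𝔩(V)` satisfy a quadratic relation modulo `lefschetz b`. -/
theorem degreeV_of_rankOneAction_eq_zero {x : FermionAlgebra V}
    (hx : ∀ a α, rankOneAction a α x = 0) :
    ((Fintype.card κ : ℂ) + 1) • degreeV b x - degreeV b (degreeV b x) =
      lefschetz b * dualLefschetz b x := by
  -- The left side is `∑ i, ∂_i (b_i ∂_j x)`. Invariance under `b_i ⊗ b_j*` turns `b_i ∂_j x` into
  -- `b_j*` times a contraction with `b_i`, and summing over `i` produces `Λ`. Multiplying by `b_j`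
  -- and summing over `j` then gives the claim.
  have h (j : κ) : (Fintype.card κ : ℂ) • contractV (b.coord j) x -
      degreeV b (contractV (b.coord j) x) = ιD V (b.coord j) * dualLefschetz b x := by
    rw [← sum_contractV_ιV_mul]
    have (i : κ) : ιV V (b i) * contractV (b.coord j) x = ιD V (b.coord j) * contractD (b i) x :=
      sub_eq_zero.1 (hx (b i) (b.coord j))
    simp only [this, contractV_ιD_mul, dualLefschetz_apply, Finset.mul_sum, contractD_contractV,
      mul_neg]
  have h2 := congrArg (fun f : κ → FermionAlgebra V ↦ ∑ j, ιV V (b j) * f j) (funext h)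
  simp only [← lefschetz_mul] at h2
  rw [← h2]
  simp only [degreeV_contractV b, mul_sub, Finset.sum_sub_distrib, ← degreeV_apply, mul_smul_comm,
    ← Finset.smul_sum, add_smul, one_smul]
  abel

end Lefschetz

/-! ### Raising and lowering operators of an `𝔰𝔩₂`-triple -/

section SlTwo

variable {M : Type*} [AddCommGroup M] [Module ℂ M] {L Λ H : M →ₗ[ℂ] M}

/-- The names refer to the degree in the exterior algebra: `L` raises it and `Λ` lowers it. On
weights of `H` the effect is opposite, so `Λ` adds two. -/
theorem weight_pow_lower (hHΛ : ∀ x, H (Λ x) - Λ (H x) = (2 : ℂ) • Λ x) {x : M} {c : ℂ}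
    (hx : H x = c • x) (r : ℕ) : H ((Λ ^ r) x) = (c + 2 * r) • (Λ ^ r) x := by
  induction r with
  | zero => simp [hx]
  | succ r ih =>
    rw [pow_succ', Module.End.mul_apply, sub_eq_iff_eq_add.1 (hHΛ _), ih, map_smul, ← add_smul]
    congr 1
    push_cast
    ring

/-- The coefficient is minus the sum of the weights `c, c + 2, …, c + 2r` picked up when `L` is
commuted past `r + 1` factors `Λ`. -/
theorem raise_pow_lower (hLΛ : ∀ x, Λ (L x) - L (Λ x) = H x)
    (hHΛ : ∀ x, H (Λ x) - Λ (H x) = (2 : ℂ) • Λ x) {x : M} {c : ℂ} (hLx : L x = 0)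
    (hx : H x = c • x) (r : ℕ) :
    L ((Λ ^ (r + 1)) x) = (-((r + 1) * (c + r))) • (Λ ^ r) x := by
  induction r with
  | zero =>
    have h := hLΛ x
    rw [hLx, map_zero, zero_sub, hx, neg_eq_iff_eq_neg, ← neg_smul] at h
    simpa using h
  | succ r ih =>
    have h := hLΛ ((Λ ^ (r + 1)) x)
    rw [ih, weight_pow_lower hHΛ hx, map_smul, ← Module.End.mul_apply Λ, ← pow_succ',
      sub_eq_iff_eq_add, ← sub_eq_iff_eq_add', ← sub_smul] at h
    rw [pow_succ' Λ (r + 1), Module.End.mul_apply, ← h]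
    congr 1
    push_cast
    ring

/-- A vector of positive weight annihilated by the operator lowering weights by two vanishes,
if the operator raising weights by two is nilpotent on it. -/
theorem eq_zero_of_raise_eq_zero (hLΛ : ∀ x, Λ (L x) - L (Λ x) = H x)
    (hHΛ : ∀ x, H (Λ x) - Λ (H x) = (2 : ℂ) • Λ x) {x : M} {c : ℕ} (hLx : L x = 0)
    (hx : H x = (c + 1 : ℂ) • x) {r : ℕ} (hr : (Λ ^ r) x = 0) : x = 0 := by
  induction r with
  | zero => simpa using hr
  | succ r ih =>
    apply ih
    have h := raise_pow_lower hLΛ hHΛ hLx hx r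
    -- For positive weight the coefficient never vanishes, so the order of nilpotency can be lowered
    -- step by step down to `x = 0`.
    rw [hr, map_zero, eq_comm, smul_eq_zero] at h
    refine h.resolve_left (neg_ne_zero.2 (mul_ne_zero ?_ ?_))
    · exact_mod_cast Nat.succ_ne_zero r
    · exact_mod_cast (show c + 1 + r ≠ 0 by omega)

theorem weight_pow_raise (hHL : ∀ x, H (L x) - L (H x) = -((2 : ℂ) • L x)) {x : M} {c : ℂ}
    (hx : H x = c • x) (r : ℕ) : H ((L ^ r) x) = (c - 2 * r) • (L ^ r) x := by
  induction r with
  | zero => simp [hx]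
  | succ r ih =>
    rw [pow_succ', Module.End.mul_apply, sub_eq_iff_eq_add.1 (hHL _), ih, map_smul, ← neg_smul,
      ← add_smul]
    congr 1
    push_cast
    ring

theorem lower_pow_raise (hLΛ : ∀ x, Λ (L x) - L (Λ x) = H x)
    (hHL : ∀ x, H (L x) - L (H x) = -((2 : ℂ) • L x)) {x : M} {c : ℂ} (hx : H x = c • x) (r : ℕ) :
    Λ ((L ^ (r + 1)) x) = (L ^ (r + 1)) (Λ x) + ((r + 1) * (c - r)) • (L ^ r) x := by
  induction r with
  | zero => simp [← hx, ← hLΛ]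
  | succ r ih =>
    have h := hLΛ ((L ^ (r + 1)) x)
    rw [ih, weight_pow_raise hHL hx, map_add, map_smul, sub_eq_iff_eq_add] at h
    rw [pow_succ' L (r + 1), Module.End.mul_apply, h, Module.End.mul_apply, pow_succ' L r,
      Module.End.mul_apply, Module.End.mul_apply, add_left_comm, ← add_smul]
    congr 2
    push_cast
    ring

/-- Commuting one `Λ` to the right removes at most one `L`. With more factors `L` than `Λ`, at least
one `L` survives on the left. -/
theorem lower_pow_raise_pow_mem_range (hLΛ : ∀ x, Λ (L x) - L (Λ x) = H x)
    (hHL : ∀ x, H (L x) - L (H x) = -((2 : ℂ) • L x))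
    (hHΛ : ∀ x, H (Λ x) - Λ (H x) = (2 : ℂ) • Λ x) (m s : ℕ) {x : M} {c : ℂ} (hx : H x = c • x) :
    (Λ ^ m) ((L ^ (m + s + 1)) x) ∈ LinearMap.range L := by
  induction m generalizing x c s with
  | zero => exact ⟨(L ^ (0 + s)) x, by rw [pow_succ', Module.End.mul_apply]; rfl⟩
  | succ m ih =>
    rw [pow_succ, Module.End.mul_apply, lower_pow_raise hLΛ hHL hx, map_add, map_smul]
    refine add_mem ?_ (Submodule.smul_mem _ _ ?_)
    · have h : H (Λ x) = (c + 2) • Λ x := by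
        have := weight_pow_lower hHΛ hx 1
        simpa using this
      rw [show m + 1 + s + 1 = m + (s + 1) + 1 by ring]
      exact ih (s + 1) h
    · rw [show m + 1 + s = m + s + 1 by ring]
      exact ih s hx

/-- A vector of negative weight is in the range of the operator lowering weights by two, if this
operator is nilpotent on it. -/
theorem mem_range_raise (hLΛ : ∀ x, Λ (L x) - L (Λ x) = H x)
    (hHL : ∀ x, H (L x) - L (H x) = -((2 : ℂ) • L x))
    (hHΛ : ∀ x, H (Λ x) - Λ (H x) = (2 : ℂ) • Λ x) {x : M} {c : ℕ}
    (hx : H x = (-(c + 1) : ℂ) • x) {r : ℕ} (hr : (L ^ r) x = 0) : x ∈ LinearMap.range L := by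
  -- Modulo the range of `L`, `Λ ^ (r + 1)` applied to `L ^ (r + 1) x` is a nonzero multiple of `Λ ^
  -- r` applied to `L ^ r x`, since the weight is negative. This allows descent from a vanishing
  -- power to `r = 0`, without decomposing into irreducible `𝔰𝔩₂`-modules.
  have key (r : ℕ) (h : (Λ ^ r) ((L ^ r) x) ∈ LinearMap.range L) : x ∈ LinearMap.range L := by
    induction r with
    | zero => simpa using h
    | succ r ih =>
      apply ih
      rw [pow_succ, Module.End.mul_apply, lower_pow_raise hLΛ hHL hx, map_add, map_smul] at h
      have h' : H (Λ x) = (-(c + 1) + 2 : ℂ) • Λ x := by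
        simpa using weight_pow_lower hHΛ hx 1
      rw [Submodule.add_mem_iff_right _ (lower_pow_raise_pow_mem_range hLΛ hHL hHΛ r 0 h')] at h
      refine (Submodule.smul_mem_iff _ ?_).1 h
      refine mul_ne_zero (by exact_mod_cast Nat.succ_ne_zero r) ?_
      rw [← neg_add', neg_ne_zero]
      exact_mod_cast (show c + 1 + r ≠ 0 by omega)
  exact key r (by rw [hr, map_zero]; exact zero_mem _)

end SlTwo

/-! ### The bigrading -/

section Bigrading

variable {V : Type} [AddCommGroup V] [Module ℂ V]

theorem ιV_mul_mem_bidegree (v : V) {i j : ℕ} {x : FermionAlgebra V} (hx : x ∈ bidegree V i j) :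
    ιV V v * x ∈ bidegree V (i + 1) j := by
  rw [bidegree, pow_succ', mul_assoc]
  exact Submodule.mul_mem_mul ⟨v, rfl⟩ hx

theorem range_ιD_mul_range_ιV :
    LinearMap.range (ιD V) * LinearMap.range (ιV V) =
      LinearMap.range (ιV V) * LinearMap.range (ιD V) := by
  have h (v : V) (f : Dual ℂ V) : ιD V f * ιV V v = -(ιV V v * ιD V f) := by
    simpa using ιD_mul_ιV_mul f v 1
  refine le_antisymm (Submodule.mul_le.2 ?_) (Submodule.mul_le.2 ?_)
  · rintro _ ⟨f, rfl⟩ _ ⟨v, rfl⟩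
    rw [h]
    exact neg_mem (Submodule.mul_mem_mul ⟨v, rfl⟩ ⟨f, rfl⟩)
  · rintro _ ⟨v, rfl⟩ _ ⟨f, rfl⟩
    rw [← neg_eq_iff_eq_neg.2 (h v f)]
    exact neg_mem (Submodule.mul_mem_mul ⟨f, rfl⟩ ⟨v, rfl⟩)

theorem ιD_mul_mem_bidegree (f : Dual ℂ V) {i j : ℕ} {x : FermionAlgebra V}
    (hx : x ∈ bidegree V i j) : ιD V f * x ∈ bidegree V i (j + 1) := by
  have h : Commute (LinearMap.range (ιD V)) (LinearMap.range (ιV V) ^ i) :=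
    Commute.pow_right (range_ιD_mul_range_ιV (V := V)) i
  change _ ∈ LinearMap.range (ιV V) ^ i * LinearMap.range (ιD V) ^ (j + 1)
  rw [pow_succ', ← mul_assoc, ← h.eq, mul_assoc]
  exact Submodule.mul_mem_mul ⟨f, rfl⟩ hx

theorem one_mem_bidegree : (1 : FermionAlgebra V) ∈ bidegree V 0 0 := by
  simp [bidegree, Submodule.one_le.1 le_rfl]

/-- To prove a property of all elements of bidegree `(i, j)`, it suffices to add a vector or a
covector on the left. -/
theorem bidegree_induction
    {motive : (i j : ℕ) → (x : FermionAlgebra V) → x ∈ bidegree V i j → Prop}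
    (one : ∀ c : ℂ, motive 0 0 (c • 1) (Submodule.smul_mem _ c one_mem_bidegree))
    (add : ∀ i j x y hx hy, motive i j x hx → motive i j y hy →
      motive i j (x + y) (add_mem hx hy))
    (vec : ∀ i j v x hx, motive i j x hx →
      motive (i + 1) j (ιV V v * x) (ιV_mul_mem_bidegree v hx))
    (covec : ∀ j f x hx, motive 0 j x hx →
      motive 0 (j + 1) (ιD V f * x) (ιD_mul_mem_bidegree f hx))
    {i j : ℕ} {x : FermionAlgebra V} (hx : x ∈ bidegree V i j) : motive i j x hx := by
  induction i generalizing x with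
  | zero =>
    induction j generalizing x with
    | zero =>
      have hx' := hx
      rw [bidegree, pow_zero, pow_zero, one_mul, Submodule.mem_one] at hx'
      obtain ⟨c, rfl⟩ := hx'
      simp only [Algebra.algebraMap_eq_smul_one]
      exact one c
    | succ j ih =>
      have hx' := hx
      rw [bidegree, pow_zero, one_mul, pow_succ'] at hx'
      suffices ∃ h, motive 0 (j + 1) x h from this.2
      clear hx
      induction hx' using Submodule.mul_induction_on' with
      | mem_mul_mem y hy z hz =>
        obtain ⟨f, rfl⟩ := hy
        have hz' : z ∈ bidegree V 0 j := by rwa [bidegree, pow_zero, one_mul]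
        exact ⟨_, covec j f z hz' (ih hz')⟩
      | add y _ z _ hy hz => exact ⟨_, add _ _ _ _ _ _ hy.2 hz.2⟩
  | succ i ih =>
    have hx' := hx
    rw [bidegree, pow_succ', mul_assoc] at hx'
    suffices ∃ h, motive (i + 1) j x h from this.2
    clear hx
    induction hx' using Submodule.mul_induction_on' with
    | mem_mul_mem y hy z hz =>
      obtain ⟨v, rfl⟩ := hy
      exact ⟨_, vec i j v z hz (ih hz)⟩
    | add y _ z _ hy hz => exact ⟨_, add _ _ _ _ _ _ hy.2 hz.2⟩

/-- The separate clause for `i = 0` makes up for the truncated subtraction, where `i - 1` is again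
`0`. The induction needs it. -/
theorem contractV_mem_bidegree (α : Dual ℂ V) {i j : ℕ} {x : FermionAlgebra V}
    (hx : x ∈ bidegree V i j) :
    (i = 0 → contractV α x = 0) ∧ contractV α x ∈ bidegree V (i - 1) j := by
  induction hx using bidegree_induction with
  | one c => simp [contractV, contract_one]
  | add i j x y _ _ hx hy =>
    rw [map_add]
    exact ⟨fun h ↦ by rw [hx.1 h, hy.1 h, add_zero], add_mem hx.2 hy.2⟩
  | vec i j v x hx ih =>
    refine ⟨fun h ↦ (Nat.succ_ne_zero i h).elim, ?_⟩
    rw [contractV_ιV_mul, Nat.add_sub_cancel]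
    refine sub_mem (Submodule.smul_mem _ _ hx) ?_
    rcases i with - | i
    · rw [ih.1 rfl, mul_zero]
      exact zero_mem _
    · exact ιV_mul_mem_bidegree v ih.2
  | covec j f x hx ih =>
    have h : contractV α (ιD V f * x) = 0 := by
      rw [contractV_ιD_mul, ih.1 rfl, mul_zero, neg_zero]
    exact ⟨fun _ ↦ h, h ▸ zero_mem _⟩

theorem contractD_mem_bidegree (a : V) {i j : ℕ} {x : FermionAlgebra V}
    (hx : x ∈ bidegree V i j) :
    (j = 0 → contractD a x = 0) ∧ contractD a x ∈ bidegree V i (j - 1) := by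
  induction hx using bidegree_induction with
  | one c => simp [contractD, contract_one]
  | add i j x y _ _ hx hy =>
    rw [map_add]
    exact ⟨fun h ↦ by rw [hx.1 h, hy.1 h, add_zero], add_mem hx.2 hy.2⟩
  | vec i j v x hx ih =>
    rw [contractD_ιV_mul]
    exact ⟨fun h ↦ by rw [ih.1 h, mul_zero, neg_zero], neg_mem (ιV_mul_mem_bidegree v ih.2)⟩
  | covec j f x hx ih =>
    refine ⟨fun h ↦ (Nat.succ_ne_zero j h).elim, ?_⟩
    rw [contractD_ιD_mul, Nat.add_sub_cancel]
    refine sub_mem (Submodule.smul_mem _ _ hx) ?_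
    rcases j with - | j
    · rw [ih.1 rfl, mul_zero]
      exact zero_mem _
    · exact ιD_mul_mem_bidegree f ih.2

theorem iSup_bidegree : ⨆ p : ℕ × ℕ, bidegree V p.1 p.2 = ⊤ := by
  rw [eq_top_iff]
  rintro x -
  have hmem {i j : ℕ} {y : FermionAlgebra V} (hy : y ∈ bidegree V i j) :
      y ∈ ⨆ p : ℕ × ℕ, bidegree V p.1 p.2 :=
    Submodule.mem_iSup_of_mem (p := fun p : ℕ × ℕ ↦ bidegree V p.1 p.2) (i, j) hy
  induction x using CliffordAlgebra.left_induction with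
  | algebraMap r =>
    refine hmem (i := 0) (j := 0) ?_
    rw [Algebra.algebraMap_eq_smul_one]
    exact Submodule.smul_mem _ r one_mem_bidegree
  | add x y hx hy => exact add_mem hx hy
  | ι_mul x m hx =>
    induction hx using Submodule.iSup_induction' with
    | mem p y hy =>
      have h : CliffordAlgebra.ι 0 m = ιV V m.1 + ιD V m.2 := by
        change ExteriorAlgebra.ι ℂ m = _
        simp [ιV, ιD, ← map_add]
      rw [h, add_mul]
      exact add_mem (hmem (ιV_mul_mem_bidegree _ hy)) (hmem (ιD_mul_mem_bidegree _ hy))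
    | zero => rw [mul_zero]; exact zero_mem _
    | add y z _ _ hy hz => rw [mul_add]; exact add_mem hy hz

section Basis

variable {κ : Type} [Fintype κ] (b : Basis κ ℂ V)

theorem degreeV_of_mem_bidegree {i j : ℕ} {x : FermionAlgebra V} (hx : x ∈ bidegree V i j) :
    degreeV b x = (i : ℂ) • x := by
  induction hx using bidegree_induction with
  | one c => simp [degreeV_one]
  | add i j x y _ _ hx hy => rw [map_add, hx, hy, smul_add]
  | vec i j v x hx ih =>
    rw [degreeV_ιV_mul, ih, mul_smul_comm]
    push_cast
    rw [add_smul, one_smul, add_comm]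
  | covec j f x hx ih => rw [degreeV_ιD_mul, ih, mul_smul_comm]

theorem degreeD_of_mem_bidegree {i j : ℕ} {x : FermionAlgebra V} (hx : x ∈ bidegree V i j) :
    degreeD b x = (j : ℂ) • x := by
  induction hx using bidegree_induction with
  | one c => simp [degreeD_one]
  | add i j x y _ _ hx hy => rw [map_add, hx, hy, smul_add]
  | vec i j v x hx ih => rw [degreeD_ιV_mul, ih, mul_smul_comm]
  | covec j f x hx ih =>
    rw [degreeD_ιD_mul, ih, mul_smul_comm]
    push_cast
    rw [add_smul, one_smul, add_comm]

theorem lefschetz_mul_mem_bidegree {i j : ℕ} {x : FermionAlgebra V} (hx : x ∈ bidegree V i j) :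
    lefschetz b * x ∈ bidegree V (i + 1) (j + 1) := by
  rw [lefschetz_mul]
  exact Submodule.sum_mem _ fun k _ ↦ ιV_mul_mem_bidegree _ (ιD_mul_mem_bidegree _ hx)

theorem lefschetz_mul_pow_mem_bidegree {i j : ℕ} {x : FermionAlgebra V} (hx : x ∈ bidegree V i j)
    (r : ℕ) : (LinearMap.mulLeft ℂ (lefschetz b) ^ r) x ∈ bidegree V (i + r) (j + r) := by
  induction r with
  | zero => simpa using hx
  | succ r ih =>
    rw [pow_succ', Module.End.mul_apply]
    exact lefschetz_mul_mem_bidegree b ih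

/-- Each application of `Λ` removes one vector of `V`, and only `i` are present. -/
theorem dualLefschetz_pow_eq_zero {i j : ℕ} {x : FermionAlgebra V} (hx : x ∈ bidegree V i j) :
    (dualLefschetz b ^ (i + 1)) x = 0 := by
  induction i generalizing j x with
  | zero =>
    rw [zero_add, pow_one, dualLefschetz_apply]
    simp [(contractV_mem_bidegree _ hx).1 rfl]
  | succ i ih =>
    rw [pow_succ, Module.End.mul_apply]
    refine ih (j := j - 1) ?_
    rw [dualLefschetz_apply]
    exact Submodule.sum_mem _ fun k _ ↦
      (contractD_mem_bidegree _ (contractV_mem_bidegree _ hx).2).2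

include b in
theorem iSupIndep_bidegree : iSupIndep fun p : ℕ × ℕ ↦ bidegree V p.1 p.2 := by
  -- A single operator with eigenvalue `i + j √-1` on bidegree `(i, j)` separates both degrees at
  -- once, so independence of eigenspaces applies.
  let N : Module.End ℂ (FermionAlgebra V) := degreeV b + Complex.I • degreeD b
  have hinj : Function.Injective fun p : ℕ × ℕ ↦ (p.1 + p.2 * Complex.I : ℂ) := by
    rintro ⟨i, j⟩ ⟨k, l⟩ h
    have h1 := congrArg Complex.re h
    have h2 := congrArg Complex.im h
    simp at h1 h2
    rw [h1, h2]
  refine (N.eigenspaces_iSupIndep.comp hinj).mono fun p x hx ↦ ?_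
  rw [Function.comp_apply, Module.End.mem_eigenspace_iff]
  simp only [N, LinearMap.add_apply, LinearMap.smul_apply, degreeV_of_mem_bidegree b hx,
    degreeD_of_mem_bidegree b hx, add_smul, mul_smul, smul_comm Complex.I]

end Basis

/-- Already `⋀^i V` vanishes for `i > dim V`. -/
theorem bidegree_eq_bot [FiniteDimensional ℂ V] {i j : ℕ} (hi : finrank ℂ V < i) :
    bidegree V i j = ⊥ := by
  have h : LinearMap.range (ExteriorAlgebra.ι ℂ : V →ₗ[ℂ] _) ^ i = ⊥ := by
    have h1 : finrank ℂ (⋀[ℂ]^i V) = 0 := by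
      rw [exteriorPower.finrank_eq, Nat.choose_eq_zero_of_lt hi]
    exact Submodule.finrank_eq_zero.1 h1
  have h2 := congrArg
    (Submodule.map (ExteriorAlgebra.map (LinearMap.inl ℂ V (Dual ℂ V))).toLinearMap) h
  rw [Submodule.map_bot, Submodule.map_pow, ← LinearMap.range_comp,
    ExteriorAlgebra.map_comp_ι] at h2
  rw [bidegree, h2, Submodule.bot_mul]

theorem isInternal_bidegree [FiniteDimensional ℂ V] :
    DirectSum.IsInternal fun p : ℕ × ℕ ↦ bidegree V p.1 p.2 :=
  DirectSum.isInternal_submodule_of_iSupIndep_of_iSup_eq_top (iSupIndep_bidegree (finBasis ℂ V))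
    iSup_bidegree

instance [FiniteDimensional ℂ V] :
    DirectSum.Decomposition fun p : ℕ × ℕ ↦ bidegree V p.1 p.2 :=
  isInternal_bidegree.chooseDecomposition _

/-- The projection of `⋀(V ⊕ V*)` onto a bihomogeneous component. -/
def bidegreeProj [FiniteDimensional ℂ V] (p : ℕ × ℕ) : FermionAlgebra V →ₗ[ℂ] FermionAlgebra V :=
  (bidegree V p.1 p.2).subtype ∘ₗ DirectSum.component ℂ (ℕ × ℕ) (fun p ↦ bidegree V p.1 p.2) p ∘ₗ
    (DirectSum.decomposeLinearEquiv fun p : ℕ × ℕ ↦ bidegree V p.1 p.2).toLinearMap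

/-! ### Properties of the bihomogeneous projections. -/

variable [FiniteDimensional ℂ V]

theorem bidegreeProj_mem (p : ℕ × ℕ) (x : FermionAlgebra V) :
    bidegreeProj p x ∈ bidegree V p.1 p.2 :=
  Subtype.coe_prop _

theorem bidegreeProj_of_mem {p : ℕ × ℕ} {x : FermionAlgebra V} (hx : x ∈ bidegree V p.1 p.2) :
    bidegreeProj p x = x :=
  DirectSum.decompose_of_mem_same (fun p : ℕ × ℕ ↦ bidegree V p.1 p.2) hx

theorem bidegreeProj_of_mem_ne {p q : ℕ × ℕ} {x : FermionAlgebra V} (hx : x ∈ bidegree V p.1 p.2)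
    (hpq : p ≠ q) : bidegreeProj q x = 0 :=
  DirectSum.decompose_of_mem_ne (fun p : ℕ × ℕ ↦ bidegree V p.1 p.2) hx hpq

theorem mem_of_bidegreeProj_mem (S : Submodule ℂ (FermionAlgebra V)) {x : FermionAlgebra V}
    (h : ∀ p, bidegreeProj p x ∈ S) : x ∈ S := by
  classical
  rw [← DirectSum.sum_support_decompose (fun p : ℕ × ℕ ↦ bidegree V p.1 p.2) x]
  exact S.sum_mem fun p _ ↦ h p

/-- A linear map shifting bidegrees commutes with the projections. -/
theorem bidegreeProj_map {f : FermionAlgebra V →ₗ[ℂ] FermionAlgebra V} {σ : ℕ × ℕ → ℕ × ℕ}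
    (hσ : Function.Injective σ)
    (hf : ∀ p, ∀ x ∈ bidegree V p.1 p.2, f x ∈ bidegree V (σ p).1 (σ p).2) (p : ℕ × ℕ)
    (x : FermionAlgebra V) : bidegreeProj (σ p) (f x) = f (bidegreeProj p x) := by
  have hx : x ∈ ⨆ p : ℕ × ℕ, bidegree V p.1 p.2 := by
    rw [iSup_bidegree]
    exact Submodule.mem_top
  induction hx using Submodule.iSup_induction' with
  | mem q y hy =>
    by_cases hqp : q = p
    · subst hqp
      rw [bidegreeProj_of_mem (hf q y hy), bidegreeProj_of_mem hy]
    · rw [bidegreeProj_of_mem_ne hy hqp, map_zero,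
        bidegreeProj_of_mem_ne (hf q y hy) (hσ.ne hqp)]
  | zero => simp
  | add y z _ _ hy hz => rw [map_add, map_add, hy, hz, map_add, map_add]

/-- A linear map shifting bidegrees has no component outside of the shifted bidegrees. -/
theorem bidegreeProj_map_eq_zero {f : FermionAlgebra V →ₗ[ℂ] FermionAlgebra V}
    {σ : ℕ × ℕ → ℕ × ℕ}
    (hf : ∀ p, ∀ x ∈ bidegree V p.1 p.2, f x ∈ bidegree V (σ p).1 (σ p).2) {q : ℕ × ℕ}
    (hq : ∀ p, σ p ≠ q) (x : FermionAlgebra V) : bidegreeProj q (f x) = 0 := by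
  have hx : x ∈ ⨆ p : ℕ × ℕ, bidegree V p.1 p.2 := by
    rw [iSup_bidegree]
    exact Submodule.mem_top
  induction hx using Submodule.iSup_induction' with
  | mem p y hy => exact bidegreeProj_of_mem_ne (hf p y hy) (hq p)
  | zero => simp
  | add y z _ _ hy hz => rw [map_add, map_add, hy, hz, add_zero]

end Bigrading

/-! ### Irreducible reflection groups -/

section IrreducibleReflectionGroups

variable {V : Type} [AddCommGroup V] [Module ℂ V]

/-- A reflection of finite order is diagonalizable. -/
theorem IsReflection.exists_root [FiniteDimensional ℂ V] {t : LinearMap.GeneralLinearGroup ℂ V}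
    (ht : IsReflection t) (hfin : IsOfFinOrder t) :
    ∃ (a : V) (α : Dual ℂ V) (ζ : ℂ), α a = 1 ∧ ζ ≠ 0 ∧ ζ ≠ 1 ∧
      ∀ v, (t : V →ₗ[ℂ] V) v = v + ((ζ - 1) * α v) • a := by
  set f : V →ₗ[ℂ] V := (t : V →ₗ[ℂ] V) - LinearMap.id with hf
  have hker : LinearMap.ker f = LinearMap.eqLocus (t : V →ₗ[ℂ] V) LinearMap.id := by
    ext v
    simp [hf, sub_eq_zero]
  have hrange : finrank ℂ (LinearMap.range f) = 1 := by
    have h := f.finrank_range_add_finrank_ker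
    rw [hker] at h
    unfold IsReflection at ht
    omega
  obtain ⟨⟨a, ha⟩, ha0, hspan⟩ := finrank_eq_one_iff'.1 hrange
  have ha0' : a ≠ 0 := fun h ↦ ha0 (Subtype.ext h)
  obtain ⟨φ, hφ⟩ : ∃ φ : Dual ℂ V, φ a ≠ 0 := by
    by_contra! h
    exact ha0' ((Module.forall_dual_apply_eq_zero_iff ℂ a).1 h)
  set β : Dual ℂ V := (φ a)⁻¹ • (φ ∘ₗ f) with hβ
  have hfβ (v : V) : f v = β v • a := by
    obtain ⟨c, hc⟩ := hspan ⟨f v, v, rfl⟩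
    have hc' : c • a = f v := congrArg Subtype.val hc
    rw [← hc', hβ, LinearMap.smul_apply, LinearMap.comp_apply, ← hc', map_smul, smul_eq_mul,
      smul_eq_mul, mul_comm c, inv_mul_cancel_left₀ hφ]
  have htβ (v : V) : (t : V →ₗ[ℂ] V) v = v + β v • a := by
    rw [← hfβ]
    simp [hf]
  -- Otherwise `t` is a transvection, whose powers `v + m β(v) a` are never the identity for `m > 0`
  -- in characteristic zero.
  have hβa : β a ≠ 0 := by
    intro h0
    have hpow (m : ℕ) (v : V) : ((t : V →ₗ[ℂ] V) ^ m) v = v + (m * β v) • a := by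
      induction m with
      | zero => simp
      | succ m ih =>
        rw [pow_succ', Module.End.mul_apply, ih, map_add, map_smul, htβ, htβ, h0, zero_smul,
          add_zero, add_assoc, ← add_smul]
        push_cast
        ring_nf
    obtain ⟨m, hm, htm⟩ := isOfFinOrder_iff_pow_eq_one.1 hfin
    have htm' : (t : V →ₗ[ℂ] V) ^ m = 1 := by rw [← Units.val_pow_eq_pow_val, htm, Units.val_one]
    obtain ⟨v, hv⟩ := ha
    have h := hpow m v
    rw [htm', Module.End.one_apply, left_eq_add, smul_eq_zero, or_iff_left ha0', mul_eq_zero,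
      Nat.cast_eq_zero, or_iff_right hm.ne'] at h
    rw [hfβ, h, zero_smul] at hv
    exact ha0' hv.symm
  refine ⟨a, (β a)⁻¹ • β, 1 + β a, by simp [hβa], fun h ↦ ha0' ?_, by simpa using hβa, fun v ↦ ?_⟩
  · have h1 : (t : V →ₗ[ℂ] V) a = 0 := by
      rw [htβ]
      nth_rewrite 1 [← one_smul ℂ a]
      rw [← add_smul, h, zero_smul]
    have h2 : (t⁻¹.1 : V →ₗ[ℂ] V) ((t : V →ₗ[ℂ] V) a) = a := by
      rw [← Module.End.mul_apply, ← Units.val_mul, inv_mul_cancel]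
      rfl
    rw [← h2, h1, map_zero]
  · rw [htβ, add_sub_cancel_left, show ((β a)⁻¹ • β) v = (β a)⁻¹ * β v from rfl,
      mul_inv_cancel_left₀ hβa]

/-- Maschke's theorem for the finite group `W`. -/
theorem exists_isCompl_invariant {W : Subgroup (LinearMap.GeneralLinearGroup ℂ V)} [Finite W]
    {U : Submodule ℂ V} (hU : ∀ g ∈ W, ∀ v ∈ U, (g : V →ₗ[ℂ] V) v ∈ U) :
    ∃ U' : Submodule ℂ V, IsCompl U U' ∧ ∀ g ∈ W, ∀ v ∈ U', (g : V →ₗ[ℂ] V) v ∈ U' := by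
  let S : Subrepresentation (reflectionRep W) := ⟨U, fun g v hv ↦ hU g g.2 v hv⟩
  have : Fintype W := Fintype.ofFinite W
  obtain ⟨S', hS'⟩ := exists_isCompl S
  refine ⟨S'.toSubmodule, ⟨?_, ?_⟩, fun g hg v hv ↦ S'.apply_mem_toSubmodule ⟨g, hg⟩ hv⟩
  · rw [disjoint_iff]
    exact congrArg Subrepresentation.toSubmodule (disjoint_iff.1 hS'.1)
  · rw [codisjoint_iff]
    exact congrArg Subrepresentation.toSubmodule (codisjoint_iff.1 hS'.2)

/-- The restriction of a linear group to an invariant subspace. -/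
def restrictHom {W : Subgroup (LinearMap.GeneralLinearGroup ℂ V)} {U : Submodule ℂ V}
    (hU : ∀ g ∈ W, ∀ v ∈ U, (g : V →ₗ[ℂ] V) v ∈ U) : W →* LinearMap.GeneralLinearGroup ℂ U :=
  MonoidHom.toHomUnits ((reflectionRep W).subrepresentation U fun g v hv ↦ hU g g.2 v hv)

theorem restrictHom_apply {W : Subgroup (LinearMap.GeneralLinearGroup ℂ V)} {U : Submodule ℂ V}
    (hU : ∀ g ∈ W, ∀ v ∈ U, (g : V →ₗ[ℂ] V) v ∈ U) (g : W) (v : U) :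
    ((restrictHom hU g : U →ₗ[ℂ] U) v : V) = (g.1 : V →ₗ[ℂ] V) v := rfl

theorem IsComplexReflectionGroup.exists_root [FiniteDimensional ℂ V]
    {W : Subgroup (LinearMap.GeneralLinearGroup ℂ V)}
    (hW : IsComplexReflectionGroup W) {t : LinearMap.GeneralLinearGroup ℂ V} (htW : t ∈ W)
    (ht : IsReflection t) :
    ∃ (a : V) (α : Dual ℂ V) (ζ : ℂ), α a = 1 ∧ ζ ≠ 0 ∧ ζ ≠ 1 ∧
      ∀ v, (t : V →ₗ[ℂ] V) v = v + ((ζ - 1) * α v) • a := by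
  have := hW.finite
  exact ht.exists_root (W.subtype.isOfFinOrder (isOfFinOrder_of_finite (⟨t, htW⟩ : W)))

theorem IsComplexReflectionGroup.induction {W : Subgroup (LinearMap.GeneralLinearGroup ℂ V)}
    (hW : IsComplexReflectionGroup W) {P : (g : LinearMap.GeneralLinearGroup ℂ V) → g ∈ W → Prop}
    (refl : ∀ t (ht : t ∈ W), IsReflection t → P t ht) (one : P 1 (one_mem W))
    (mul : ∀ g hg h hh, P g hg → P h hh → P (g * h) (mul_mem hg hh))
    (inv : ∀ g hg, P g hg → P g⁻¹ (inv_mem hg))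
    {g : LinearMap.GeneralLinearGroup ℂ V} (hg : g ∈ W) : P g hg := by
  suffices ∃ h, P g h from this.2
  rw [← hW.generated] at hg
  induction hg using Subgroup.closure_induction with
  | mem t ht => exact ⟨_, refl t ht.1 ht.2⟩
  | one => exact ⟨_, one⟩
  | mul x y hx hy hPx hPy => exact ⟨_, mul x hPx.1 y hPy.1 hPx.2 hPy.2⟩
  | inv x hx hPx => exact ⟨_, inv x hPx.1 hPx.2⟩

/-- A reflection with linear form `α` restricts to the identity of `U` if `α` vanishes on `U`, and
to a reflection of `U` otherwise. So the images of the generators are reflections or trivial. -/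
theorem IsComplexReflectionGroup.restrict [FiniteDimensional ℂ V]
    {W : Subgroup (LinearMap.GeneralLinearGroup ℂ V)}
    (hW : IsComplexReflectionGroup W) {U : Submodule ℂ V}
    (hU : ∀ g ∈ W, ∀ v ∈ U, (g : V →ₗ[ℂ] V) v ∈ U) :
    IsComplexReflectionGroup (restrictHom hU).range where
  finite := by
    have := hW.finite
    exact Set.finite_range (restrictHom hU)
  generated := by
    set S := {t | t ∈ (restrictHom hU).range ∧ IsReflection t} with hS
    refine le_antisymm ((Subgroup.closure_le _).2 fun t ht ↦ ht.1) ?_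
    rintro _ ⟨⟨g, hg⟩, rfl⟩
    induction hg using hW.induction with
    | one =>
      rw [show (⟨1, one_mem W⟩ : W) = 1 from rfl, map_one]
      exact one_mem _
    | mul g hg h hh hPg hPh =>
      rw [show (⟨g * h, mul_mem hg hh⟩ : W) = ⟨g, hg⟩ * ⟨h, hh⟩ from rfl, map_mul]
      exact mul_mem hPg hPh
    | inv g hg hPg =>
      rw [show (⟨g⁻¹, inv_mem hg⟩ : W) = ⟨g, hg⟩⁻¹ from rfl, map_inv]
      exact inv_mem hPg
    | refl t htW ht =>
      obtain ⟨a, α, ζ, haα, hζ, hζ1, hta⟩ := hW.exists_root htW ht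
      have ha : a ≠ 0 := by
        rintro rfl
        simp at haα
      by_cases hα : α ∘ₗ U.subtype = 0
      · have h1 : restrictHom hU ⟨t, htW⟩ = 1 := by
          refine Units.ext (LinearMap.ext fun v ↦ Subtype.ext ?_)
          rw [restrictHom_apply, hta, show α v = 0 from LinearMap.congr_fun hα v]
          simp
        rw [h1]
        exact one_mem _
      · refine Subgroup.subset_closure ⟨⟨_, rfl⟩, ?_⟩
        have hlocus : LinearMap.eqLocus (restrictHom hU ⟨t, htW⟩ : U →ₗ[ℂ] U) LinearMap.id =
            LinearMap.ker (α ∘ₗ U.subtype) := by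
          ext v
          rw [LinearMap.mem_eqLocus, LinearMap.mem_ker, ← Subtype.coe_inj, restrictHom_apply, hta]
          simp [sub_eq_zero, hζ1, ha]
        rw [IsReflection, hlocus]
        exact Module.Dual.finrank_ker_add_one_of_ne_zero (f := α ∘ₗ U.subtype) hα

/-- This says that `W` contains the two factors of the decomposition. It holds for reflections
because each acts trivially on `U` or on `U'`, and it passes to products and inverses. -/
theorem IsComplexReflectionGroup.exists_extend_by_id [FiniteDimensional ℂ V]
    {W : Subgroup (LinearMap.GeneralLinearGroup ℂ V)}
    (hW : IsComplexReflectionGroup W) {U U' : Submodule ℂ V} (hUU' : IsCompl U U')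
    (hU : ∀ g ∈ W, ∀ v ∈ U, (g : V →ₗ[ℂ] V) v ∈ U)
    (hU' : ∀ g ∈ W, ∀ v ∈ U', (g : V →ₗ[ℂ] V) v ∈ U') {g : LinearMap.GeneralLinearGroup ℂ V}
    (hg : g ∈ W) :
    ∃ h ∈ W, (∀ v ∈ U, (h : V →ₗ[ℂ] V) v = (g : V →ₗ[ℂ] V) v) ∧
      ∀ v ∈ U', (h : V →ₗ[ℂ] V) v = v := by
  induction hg using hW.induction with
  | one => exact ⟨1, one_mem W, fun v _ ↦ rfl, fun v _ ↦ rfl⟩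
  | mul g hg g' hg' hPg hPg' =>
    obtain ⟨h, hh, h1, h2⟩ := hPg
    obtain ⟨h', hh', h1', h2'⟩ := hPg'
    refine ⟨h * h', mul_mem hh hh', fun v hv ↦ ?_, fun v hv ↦ ?_⟩
    · rw [Units.val_mul, Units.val_mul, Module.End.mul_apply, Module.End.mul_apply, h1' v hv,
        h1 _ (hU g' hg' v hv)]
    · rw [Units.val_mul, Module.End.mul_apply, h2' v hv, h2 v hv]
  | inv g hg hPg =>
    obtain ⟨h, hh, h1, h2⟩ := hPg
    have hinv (k : LinearMap.GeneralLinearGroup ℂ V) (v : V) :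
        (k⁻¹.1 : V →ₗ[ℂ] V) ((k : V →ₗ[ℂ] V) v) = v := by
      rw [← Module.End.mul_apply, ← Units.val_mul, inv_mul_cancel]
      rfl
    refine ⟨h⁻¹, inv_mem hh, fun v hv ↦ ?_, fun v hv ↦ ?_⟩
    · have := h1 _ (hU _ (inv_mem hg) v hv)
      have hv' := hinv g⁻¹ v
      rw [inv_inv] at hv'
      rw [hv'] at this
      rw [← hinv h ((g⁻¹.1 : V →ₗ[ℂ] V) v), this]
    · conv_lhs => rw [← h2 v hv]
      exact hinv h v
  | refl t htW ht =>
    obtain ⟨a, α, ζ, haα, hζ, hζ1, hta⟩ := hW.exists_root htW ht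
    by_cases hα : ∀ v ∈ U', α v = 0
    · exact ⟨t, htW, fun v _ ↦ rfl, fun v hv ↦ by simp [hta, hα v hv]⟩
    -- If `α` is nonzero somewhere on an invariant subspace, then `t v - v` puts the root `a` there.
    -- It cannot lie in both `U` and `U'`, so `α` not vanishing on `U'` forces `t` to be trivial on
    -- `U`, and `1` is the required extension.
    · have root_mem {X : Submodule ℂ V} (hX : ∀ g ∈ W, ∀ v ∈ X, (g : V →ₗ[ℂ] V) v ∈ X) {v : V}
          (hv : v ∈ X) (hαv : α v ≠ 0) : a ∈ X := by
        have h := hX t htW v hv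
        rw [hta, Submodule.add_mem_iff_right _ hv] at h
        exact (Submodule.smul_mem_iff _ (mul_ne_zero (sub_ne_zero.2 hζ1) hαv)).1 h
      push Not at hα
      obtain ⟨v', hv', hαv'⟩ := hα
      refine ⟨1, one_mem W, fun v hv ↦ ?_, fun v hv ↦ rfl⟩
      by_contra hne
      have hαv : α v ≠ 0 := by
        rintro h
        exact hne (by simp [hta, h])
      have ha : a ∈ U ⊓ U' := ⟨root_mem hU hv hαv, root_mem hU' hv' hαv'⟩
      rw [hUU'.inf_eq_bot, Submodule.mem_bot] at ha
      simp [ha] at haα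

theorem IsComplexReflectionGroup.isDirectProduct [FiniteDimensional ℂ V]
    {W : Subgroup (LinearMap.GeneralLinearGroup ℂ V)}
    (hW : IsComplexReflectionGroup W) {U U' : Submodule ℂ V} (hUU' : IsCompl U U')
    (hU : ∀ g ∈ W, ∀ v ∈ U, (g : V →ₗ[ℂ] V) v ∈ U)
    (hU' : ∀ g ∈ W, ∀ v ∈ U', (g : V →ₗ[ℂ] V) v ∈ U') :
    IsDirectProduct W U U' (restrictHom hU).range (restrictHom hU').range := by
  intro g
  refine ⟨fun hg ↦ ⟨_, ⟨⟨g, hg⟩, rfl⟩, _, ⟨⟨g, hg⟩, rfl⟩, fun v ↦ rfl, fun v ↦ rfl⟩, ?_⟩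
  rintro ⟨_, ⟨⟨w₁, hw₁⟩, rfl⟩, _, ⟨⟨w₂, hw₂⟩, rfl⟩, h₁, h₂⟩
  obtain ⟨k₁, hk₁, e₁, f₁⟩ := hW.exists_extend_by_id hUU' hU hU' hw₁
  obtain ⟨k₂, hk₂, e₂, f₂⟩ := hW.exists_extend_by_id hUU'.symm hU' hU hw₂
  have : g = k₁ * k₂ := by
    refine Units.ext (LinearMap.ext fun v ↦ ?_)
    obtain ⟨u, hu, u', hu', rfl⟩ :=
      Submodule.mem_sup.1 (hUU'.sup_eq_top ▸ Submodule.mem_top : v ∈ U ⊔ U')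
    rw [map_add, map_add, h₁ ⟨u, hu⟩, h₂ ⟨u', hu'⟩, restrictHom_apply, restrictHom_apply,
      Units.val_mul, Module.End.mul_apply, Module.End.mul_apply, f₂ u hu, e₁ u hu, e₂ u' hu',
      f₁ _ (hU' w₂ hw₂ u' hu')]
  rw [this]
  exact mul_mem hk₁ hk₂

/-- An irreducible reflection group acts irreducibly on its reflection representation. -/
theorem IsComplexReflectionGroup.eq_bot_or_eq_top [FiniteDimensional ℂ V]
    {W : Subgroup (LinearMap.GeneralLinearGroup ℂ V)}
    (hW : IsComplexReflectionGroup W) (hirr : IsIrreducibleReflectionGroup W) {U : Submodule ℂ V}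
    (hU : ∀ g ∈ W, ∀ v ∈ U, (g : V →ₗ[ℂ] V) v ∈ U) : U = ⊥ ∨ U = ⊤ := by
  have := hW.finite
  obtain ⟨U', hUU', hU'⟩ := exists_isCompl_invariant hU
  refine (hirr U U' _ _ hUU' (hW.restrict hU) (hW.restrict hU')
    (hW.isDirectProduct hUU' hU hU')).imp_right ?_
  rintro rfl
  simpa using hUU'.sup_eq_top

end IrreducibleReflectionGroups

/-! ### Invariants of reflection groups in `⋀(V ⊕ V*)` -/

section Invariants

variable {V : Type} [AddCommGroup V] [Module ℂ V]

/-- Invariance is tested on the rank one parts of the reflections, which is the form in which the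
bracket argument supplies it. -/
theorem IsComplexReflectionGroup.invariant_of_root [FiniteDimensional ℂ V]
    {W : Subgroup (LinearMap.GeneralLinearGroup ℂ V)}
    (hW : IsComplexReflectionGroup W) {U : Submodule ℂ V}
    (hU : ∀ (t : LinearMap.GeneralLinearGroup ℂ V) (b : V) (β : Dual ℂ V) (ζ : ℂ), t ∈ W →
      IsReflection t → β b = 1 → ζ ≠ 0 → ζ ≠ 1 →
      (∀ v, (t : V →ₗ[ℂ] V) v = v + ((ζ - 1) * β v) • b) → ∀ v ∈ U, β v • b ∈ U)
    {g : LinearMap.GeneralLinearGroup ℂ V} (hg : g ∈ W) (v : V) (hv : v ∈ U) :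
    (g : V →ₗ[ℂ] V) v ∈ U := by
  -- The equivalence, unlike the implication, passes to inverses. Its converse for a reflection uses
  -- that `t` multiplies `β` by `ζ ≠ 0`.
  suffices ∀ v, v ∈ U ↔ (g : V →ₗ[ℂ] V) v ∈ U from (this v).1 hv
  clear hv v
  induction hg using hW.induction with
  | one => exact fun v ↦ Iff.rfl
  | mul g hg h hh hPg hPh => exact fun v ↦ (hPh v).trans (hPg _)
  | inv g hg hPg =>
    intro v
    rw [hPg ((g⁻¹.1 : V →ₗ[ℂ] V) v), ← Module.End.mul_apply, ← Units.val_mul, mul_inv_cancel]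
    rfl
  | refl t htW ht =>
    intro v
    obtain ⟨b, β, ζ, hb, hζ, hζ1, htb⟩ := hW.exists_root htW ht
    have h := hU t b β ζ htW ht hb hζ hζ1 htb
    refine ⟨fun hv ↦ ?_, fun hv ↦ ?_⟩
    · rw [htb, mul_smul]
      exact add_mem hv (Submodule.smul_mem _ _ (h v hv))
    · have h' := h _ hv
      have hβ : β ((t : V →ₗ[ℂ] V) v) = ζ * β v := by
        rw [htb, map_add, map_smul, hb, smul_eq_mul]
        ring
      rw [hβ, mul_smul, Submodule.smul_mem_iff _ hζ] at h'
      rw [htb, mul_smul] at hv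
      exact (Submodule.add_mem_iff_left _ (Submodule.smul_mem _ _ h')).1 hv

/-- An invariant of a reflection group is annihilated by the rank one operators attached to its
reflections. -/
theorem rankOneAction_root_eq_zero {W : Subgroup (LinearMap.GeneralLinearGroup ℂ V)}
    {t : LinearMap.GeneralLinearGroup ℂ V} (htW : t ∈ W) {a : V} {α : Dual ℂ V} {ζ : ℂ}
    (haα : α a = 1) (hζ : ζ ≠ 0) (hζ1 : ζ ≠ 1)
    (hta : ∀ v, (t : V →ₗ[ℂ] V) v = v + ((ζ - 1) * α v) • a) {x : FermionAlgebra V}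
    (hx : ∀ g, fermionMap (reflectionRep W) g x = x) : rankOneAction a α x = 0 := by
  refine rankOneAction_eq_zero_of_fixed haα hζ hζ1
    (S := ((reflectionRep W).prod (reflectionRep W).dual) ⟨t, htW⟩) (fun v f ↦ ?_) (hx ⟨t, htW⟩)
  refine Prod.ext (hta v) (LinearMap.ext fun w ↦ ?_)
  -- The action on `V*` is contragredient, and `t⁻¹` is the same rank one perturbation with `ζ`
  -- replaced by `ζ⁻¹`.
  have hinv : (t⁻¹.1 : V →ₗ[ℂ] V) w = w + ((ζ⁻¹ - 1) * α w) • a := by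
    have h1 : (t : V →ₗ[ℂ] V) (w + ((ζ⁻¹ - 1) * α w) • a) = w := by
      rw [hta, map_add, map_smul, haα, add_assoc, ← add_smul, smul_eq_mul, mul_one]
      convert add_zero w
      rw [smul_eq_zero]
      left
      field_simp
      ring
    conv_lhs => rw [← h1]
    rw [← Module.End.mul_apply, ← Units.val_mul, inv_mul_cancel]
    rfl
  change f ((t⁻¹.1 : V →ₗ[ℂ] V) w) = _
  rw [hinv]
  simp
  ring

/-- An invariant of an irreducible reflection group is annihilated by `𝔤𝔩(V)`. -/
theorem rankOneAction_eq_zero_of_invariant [FiniteDimensional ℂ V]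
    {W : Subgroup (LinearMap.GeneralLinearGroup ℂ V)}
    (hW : IsComplexReflectionGroup W) (hirr : IsIrreducibleReflectionGroup W)
    (hne : finrank ℂ V = 1 → W ≠ ⊥) {x : FermionAlgebra V}
    (hx : ∀ g, fermionMap (reflectionRep W) g x = x) (v : V) (f : Dual ℂ V) :
    rankOneAction v f x = 0 := by
  have root (t : LinearMap.GeneralLinearGroup ℂ V) (htW : t ∈ W) {a : V} {α : Dual ℂ V} {ζ : ℂ}
      (haα : α a = 1) (hζ : ζ ≠ 0) (hζ1 : ζ ≠ 1)
      (hta : ∀ v, (t : V →ₗ[ℂ] V) v = v + ((ζ - 1) * α v) • a) (v : V) :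
      rankOneAction v α x = 0 := by
    -- For a fixed root form `α`, the vectors `v` such that `v ⊗ α` kills `x` are stable under all
    -- `β ⊗ b` by the bracket argument. This subspace contains `a ≠ 0`, so it is all of `V`.
    let U : Submodule ℂ V :=
      { carrier := {v | rankOneAction v α x = 0}
        add_mem' := fun {v w} (hv : rankOneAction v α x = 0) (hw : rankOneAction w α x = 0) ↦
          show rankOneAction (v + w) α x = 0 by rw [rankOneAction_add_left, hv, hw, add_zero]
        zero_mem' := show rankOneAction 0 α x = 0 by
          rw [← zero_smul ℂ (0 : V), rankOneAction_smul_left, zero_smul]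
        smul_mem' := fun c v (hv : rankOneAction v α x = 0) ↦
          show rankOneAction (c • v) α x = 0 by rw [rankOneAction_smul_left, hv, smul_zero] }
    have haU : a ∈ U := rankOneAction_root_eq_zero htW haα hζ hζ1 hta hx
    have hU := hW.eq_bot_or_eq_top hirr (U := U) fun g hg v hv ↦
      hW.invariant_of_root (fun s b β ξ hsW hs hb hξ hξ1 hsb w hw ↦
        rankOneAction_eq_zero_of_bracket hb
          (rankOneAction_root_eq_zero hsW hb hξ hξ1 hsb hx) hw) hg v hv
    rcases hU with hU | hU
    · rw [hU, Submodule.mem_bot] at haU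
      simp [haU] at haα
    · exact (hU ▸ Submodule.mem_top : v ∈ U)
  let F : Submodule ℂ (Dual ℂ V) :=
    { carrier := {f | ∀ v, rankOneAction v f x = 0}
      add_mem' := fun {f g} hf hg v ↦ by rw [rankOneAction_add_right, hf, hg, add_zero]
      zero_mem' := fun v ↦ by
        rw [← zero_smul ℂ (0 : Dual ℂ V), rankOneAction_smul_right, zero_smul]
      smul_mem' := fun c f hf v ↦ by rw [rankOneAction_smul_right, hf, smul_zero] }
  -- Every root form lies in `F`, so the reflections fix the common zeros of `F` pointwise. These
  -- zeros thus form an invariant subspace.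
  have hF := hW.eq_bot_or_eq_top hirr (U := F.dualCoannihilator) fun g hg v hv ↦
    hW.invariant_of_root (fun s b β ξ hsW hs hb hξ hξ1 hsb w hw ↦ by
      rw [(Submodule.mem_dualCoannihilator w).1 hw β (root s hsW hb hξ hξ1 hsb), zero_smul]
      exact zero_mem _) hg v hv
  rcases hF with hF | hF
  · have : F = ⊤ := by
      rw [← Subspace.dualCoannihilator_dualAnnihilator_eq (W := F), hF, Submodule.dualAnnihilator_bot]
    exact (this ▸ Submodule.mem_top : f ∈ F) v
  -- If all of `V` were killed by `F`, no root form could exist, since `β b = 1`. Then `W` is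
  -- trivial, every line is invariant, and a nonzero `V` has dimension one, which is the excluded
  -- case.
  · have hbot : W = ⊥ := by
      rw [← hW.generated, Subgroup.closure_eq_bot_iff]
      rintro t ⟨htW, ht⟩
      obtain ⟨b, β, ζ, hb, hζ, hζ1, htb⟩ := hW.exists_root htW ht
      have h1 : b ∈ F.dualCoannihilator := hF ▸ Submodule.mem_top
      have h2 := (Submodule.mem_dualCoannihilator b).1 h1 β (root t htW hb hζ hζ1 htb)
      rw [hb] at h2
      exact (one_ne_zero h2).elim
    by_cases hv : v = 0
    · rw [hv, ← zero_smul ℂ (0 : V), rankOneAction_smul_left, zero_smul]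
    · have hspan := hW.eq_bot_or_eq_top hirr (U := ℂ ∙ v) fun g hg w hw ↦ by
        rw [hbot, Subgroup.mem_bot] at hg
        rw [hg]
        exact hw
      rw [Submodule.span_singleton_eq_bot, or_iff_right hv] at hspan
      refine (hne ?_ hbot).elim
      rw [← finrank_top ℂ V, ← hspan, finrank_span_singleton hv]

end Invariants

/-! ### The coinvariant ideal is generated by the Lefschetz element -/

section CoinvariantIdeal

variable {V : Type} [AddCommGroup V] [Module ℂ V] {κ : Type} [Fintype κ] (b : Basis κ ℂ V)
  {G : Type} [Group G] (ρ : Representation ℂ G V)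

theorem ι_eq_ιV_add_ιD (m : V × Dual ℂ V) : ExteriorAlgebra.ι ℂ m = ιV V m.1 + ιD V m.2 := by
  simp [ιV, ιD, ← map_add]

/-- The canonical element has even degree, hence is central. -/
theorem lefschetz_mul_comm (x : FermionAlgebra V) : lefschetz b * x = x * lefschetz b := by
  induction x using CliffordAlgebra.left_induction with
  | algebraMap r => exact (Algebra.commutes r (lefschetz b)).symm
  | add x y hx hy => rw [mul_add, hx, hy, add_mul]
  | ι_mul x m hx =>
    rw [mul_assoc, ← hx, show CliffordAlgebra.ι 0 m = _ from ι_eq_ιV_add_ιD m, add_mul, mul_add,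
      lefschetz_mul_ιV_mul, lefschetz_mul_ιD_mul, add_mul]

theorem fermionMap_ιV (g : G) (v : V) : fermionMap ρ g (ιV V v) = ιV V (ρ g v) := by
  simp [fermionMap, ιV]

theorem fermionMap_ιD (g : G) (f : Dual ℂ V) : fermionMap ρ g (ιD V f) = ιD V (ρ.dual g f) := by
  simp [fermionMap, ιD]

/-- The canonical element corresponds to the identity of `V`, which is fixed by conjugation; in
coordinates, the matrix of `g` cancels against that of the contragredient action. -/
theorem fermionMap_lefschetz (g : G) : fermionMap ρ g (lefschetz b) = lefschetz b := by
  have h (k : κ) : ∑ j, b.coord k (ρ g (b j)) • ρ.dual g (b.coord j) = b.coord k := by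
    simp_rw [← map_smul, ← map_sum]
    have h1 := sum_apply_smul_coord b (b.coord k ∘ₗ ρ g)
    simp only [LinearMap.comp_apply] at h1
    rw [h1]
    refine LinearMap.ext fun v ↦ ?_
    rw [Representation.dual_apply, Module.Dual.transpose_apply, LinearMap.comp_apply,
      LinearMap.comp_apply, ← Module.End.mul_apply, ← map_mul, mul_inv_cancel, map_one,
      Module.End.one_apply]
  simp only [lefschetz, map_sum, map_mul, fermionMap_ιV, fermionMap_ιD]
  calc
    _ = ∑ j, ∑ k, b.coord k (ρ g (b j)) • (ιV V (b k) * ιD V (ρ.dual g (b.coord j))) := by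
      refine Finset.sum_congr rfl fun j _ ↦ ?_
      conv_lhs => rw [← sum_coord_smul b (ρ g (b j)), map_sum, Finset.sum_mul]
      simp
    _ = ∑ k, ιV V (b k) * ιD V (∑ j, b.coord k (ρ g (b j)) • ρ.dual g (b.coord j)) := by
      rw [Finset.sum_comm]
      simp only [map_sum, map_smul, Finset.mul_sum, mul_smul_comm]
    _ = _ := by simp only [h]

theorem algebraMapInv_lefschetz : ExteriorAlgebra.algebraMapInv (lefschetz b) = (0 : ℂ) := by
  simp [lefschetz, ιV, ExteriorAlgebra.algebraMapInv]

/-- A bihomogeneous element annihilated by `𝔤𝔩(V)` is a multiple of the Lefschetz element, unless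
it is constant. -/
theorem exists_lefschetz_mul_of_mem_bidegree [FiniteDimensional ℂ V] {x : FermionAlgebra V}
    {i j : ℕ} (hij : (i, j) ≠ (0, 0)) (hxij : x ∈ bidegree V i j)
    (hx : ∀ a α, rankOneAction a α x = 0) : ∃ y, lefschetz b * y = x := by
  by_cases hne : x = 0
  · exact ⟨0, by rw [hne, mul_zero]⟩
  -- The sum of all `b_k ⊗ b_k*` is the identity of `V`, which acts by `i - j`. A nonzero invariant
  -- thus has `i = j`.
  have hN : degreeV b x = degreeD b x := by
    rw [degreeV_apply, degreeD_apply]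
    exact Finset.sum_congr rfl fun k _ ↦ sub_eq_zero.1 (hx (b k) (b.coord k))
  rw [degreeV_of_mem_bidegree b hxij, degreeD_of_mem_bidegree b hxij, ← sub_eq_zero, ← sub_smul,
    smul_eq_zero, or_iff_left hne, sub_eq_zero, Nat.cast_inj] at hN
  subst hN
  have hi : i ≤ Fintype.card κ := by
    by_contra! h
    rw [← finrank_eq_card_basis b] at h
    rw [bidegree_eq_bot h, Submodule.mem_bot] at hxij
    exact hne hxij
  have hi0 : i ≠ 0 := fun h ↦ hij (by rw [h])
  have h := degreeV_of_rankOneAction_eq_zero b hx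
  rw [degreeV_of_mem_bidegree b hxij, map_smul, degreeV_of_mem_bidegree b hxij, smul_smul,
    smul_smul, ← sub_smul, ← sub_mul] at h
  -- The scalar by which `LΛ` acts on `x`. It is nonzero because `0 < i ≤ n`.
  set c : ℂ := ((Fintype.card κ : ℂ) + 1 - i) * i with hc
  have hc0 : c ≠ 0 := by
    refine mul_ne_zero (sub_ne_zero.2 ?_) (Nat.cast_ne_zero.2 hi0)
    exact_mod_cast (show Fintype.card κ + 1 ≠ i by omega)
  exact ⟨c⁻¹ • dualLefschetz b x, by rw [mul_smul_comm, ← h, inv_smul_smul₀ hc0]⟩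

theorem fermionMap_bidegreeProj [FiniteDimensional ℂ V] (g : G) (p : ℕ × ℕ)
    (x : FermionAlgebra V) :
    bidegreeProj p (fermionMap ρ g x) = fermionMap ρ g (bidegreeProj p x) :=
  bidegreeProj_map (f := (fermionMap ρ g).toLinearMap) (σ := id) Function.injective_id
    (fun p x hx ↦ bidegree_map_le ρ p.1 p.2 g ⟨x, hx, rfl⟩) p x

/-- The group preserves bidegrees, so every component of an invariant is invariant and the
bihomogeneous case applies to all but the constant one. -/
theorem exists_lefschetz_mul_of_invariant [FiniteDimensional ℂ V]
    (hρ : ∀ x, (∀ g, fermionMap ρ g x = x) → ∀ a α, rankOneAction a α x = 0)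
    {x : FermionAlgebra V} (hx : ∀ g, fermionMap ρ g x = x)
    (hx0 : ExteriorAlgebra.algebraMapInv x = 0) : ∃ y, lefschetz b * y = x := by
  have hp (p : ℕ × ℕ) (h0 : p ≠ (0, 0)) : ∃ y, lefschetz b * y = bidegreeProj p x :=
    exists_lefschetz_mul_of_mem_bidegree b h0 (bidegreeProj_mem p x)
      (hρ _ fun g ↦ by rw [← fermionMap_bidegreeProj, hx])
  have hmem : x - bidegreeProj (0, 0) x ∈ LinearMap.range (LinearMap.mulLeft ℂ (lefschetz b)) := by
    refine mem_of_bidegreeProj_mem _ fun p ↦ ?_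
    by_cases h0 : p = (0, 0)
    · rw [h0, map_sub, bidegreeProj_of_mem (bidegreeProj_mem (0, 0) x), sub_self]
      exact zero_mem _
    · rw [map_sub, bidegreeProj_of_mem_ne (bidegreeProj_mem (0, 0) x) (Ne.symm h0), sub_zero]
      exact hp p h0
  obtain ⟨y, hy⟩ := hmem
  rw [LinearMap.mulLeft_apply] at hy
  have h00 := bidegreeProj_mem (0, 0) x
  rw [bidegree, pow_zero, pow_zero, one_mul, Submodule.mem_one] at h00
  obtain ⟨c, hc⟩ := h00
  have hc0 := congrArg ExteriorAlgebra.algebraMapInv hy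
  rw [map_mul, algebraMapInv_lefschetz, zero_mul, map_sub, hx0, ← hc,
    ExteriorAlgebra.algebraMap_leftInverse, zero_sub, eq_comm, neg_eq_zero] at hc0
  exact ⟨y, by rw [hy, ← hc, hc0, map_zero, sub_zero]⟩

theorem mem_coinvariantIdeal_iff [FiniteDimensional ℂ V]
    (hρ : ∀ x, (∀ g, fermionMap ρ g x = x) → ∀ a α, rankOneAction a α x = 0)
    {x : FermionAlgebra V} : x ∈ coinvariantIdeal ρ ↔ ∃ y, lefschetz b * y = x := by
  constructor
  · intro hx
    -- Since the canonical element is central, its right multiples already form a two-sided ideal.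
    let I : TwoSidedIdeal (FermionAlgebra V) := TwoSidedIdeal.mk' {x | ∃ y, lefschetz b * y = x}
      ⟨0, mul_zero _⟩ (fun ⟨y, hy⟩ ⟨z, hz⟩ ↦ ⟨y + z, by rw [mul_add, hy, hz]⟩)
      (fun ⟨y, hy⟩ ↦ ⟨-y, by rw [mul_neg, hy]⟩)
      (fun {z w} ⟨y, hy⟩ ↦ ⟨z * y, by rw [← hy, ← mul_assoc, lefschetz_mul_comm, mul_assoc]⟩)
      (fun {z w} ⟨y, hy⟩ ↦ ⟨y * w, by rw [← hy, mul_assoc]⟩)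
    have hmem (z : FermionAlgebra V) : z ∈ I ↔ ∃ y, lefschetz b * y = z :=
      TwoSidedIdeal.mem_mk' _ _ _ _ _ _ z
    have hI : TwoSidedIdeal.span {x : FermionAlgebra V |
        (∀ g, fermionMap ρ g x = x) ∧ ExteriorAlgebra.algebraMapInv x = 0} ≤ I := by
      rw [TwoSidedIdeal.span_le]
      intro y hy
      exact (hmem y).2 (exists_lefschetz_mul_of_invariant b ρ hρ hy.1 hy.2)
    exact (hmem x).1 (hI (TwoSidedIdeal.mem_asIdeal.1 hx))
  · rintro ⟨y, rfl⟩
    rw [lefschetz_mul_comm]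
    exact Ideal.mul_mem_left _ _ (TwoSidedIdeal.mem_asIdeal.2 (TwoSidedIdeal.subset_span
      ⟨fermionMap_lefschetz b ρ, algebraMapInv_lefschetz b⟩))

end CoinvariantIdeal

/-! ### The hard Lefschetz property -/

section HardLefschetz

variable {V : Type} [AddCommGroup V] [Module ℂ V] {κ : Type} [Fintype κ] (b : Basis κ ℂ V)

/-- The weight operator of the `𝔰𝔩₂`-triple containing the multiplication by the Lefschetz
element. -/
def weight : FermionAlgebra V →ₗ[ℂ] FermionAlgebra V :=
  (Fintype.card κ : ℂ) • LinearMap.id - degreeV b - degreeD b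

theorem weight_of_mem_bidegree {i j : ℕ} {x : FermionAlgebra V} (hx : x ∈ bidegree V i j) :
    weight b x = ((Fintype.card κ : ℂ) - i - j) • x := by
  simp [weight, degreeV_of_mem_bidegree b hx, degreeD_of_mem_bidegree b hx, sub_smul]

theorem weight_lefschetz_mul (x : FermionAlgebra V) :
    weight b (LinearMap.mulLeft ℂ (lefschetz b) x) -
      LinearMap.mulLeft ℂ (lefschetz b) (weight b x) =
      -((2 : ℂ) • LinearMap.mulLeft ℂ (lefschetz b) x) := by
  simp only [weight, LinearMap.sub_apply, LinearMap.smul_apply, LinearMap.id_apply,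
    LinearMap.mulLeft_apply, degreeV_lefschetz_mul, degreeD_lefschetz_mul, mul_sub, mul_smul_comm,
    two_smul]
  abel

theorem weight_dualLefschetz (x : FermionAlgebra V) :
    weight b (dualLefschetz b x) - dualLefschetz b (weight b x) =
      (2 : ℂ) • dualLefschetz b x := by
  have h1 : degreeV b (dualLefschetz b x) = dualLefschetz b (degreeV b x) - dualLefschetz b x := by
    simp [dualLefschetz_apply, degreeV_contractD, degreeV_contractV b, Finset.sum_sub_distrib]
  have h2 : degreeD b (dualLefschetz b x) = dualLefschetz b (degreeD b x) - dualLefschetz b x := by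
    simp [dualLefschetz_apply, degreeD_contractD, degreeD_contractV b, Finset.sum_sub_distrib]
  simp only [weight, LinearMap.sub_apply, LinearMap.smul_apply, LinearMap.id_apply, h1, h2,
    map_sub, map_smul, two_smul]
  abel

theorem lefschetz_injective {i j : ℕ} (hij : i + j < Fintype.card κ) {x : FermionAlgebra V}
    (hx : x ∈ bidegree V i j) (h : lefschetz b * x = 0) : x = 0 := by
  obtain ⟨c, hc⟩ := Nat.exists_eq_add_of_lt hij
  refine eq_zero_of_raise_eq_zero (L := LinearMap.mulLeft ℂ (lefschetz b)) (H := weight b) (c := c)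
    (fun x ↦ ?_) (weight_dualLefschetz b) h ?_ (dualLefschetz_pow_eq_zero b hx)
  · exact dualLefschetz_lefschetz_mul b x
  · rw [weight_of_mem_bidegree b hx, hc]
    congr 1
    push_cast
    ring

theorem lefschetz_surjective [FiniteDimensional ℂ V] {i j : ℕ} (hij : Fintype.card κ < i + j)
    {x : FermionAlgebra V} (hx : x ∈ bidegree V i j) : ∃ y, lefschetz b * y = x := by
  obtain ⟨c, hc⟩ := Nat.exists_eq_add_of_lt hij
  -- The exponent `n + 1` moves the degree in `V` beyond `n`, where the component vanishes.
  refine mem_range_raise (L := LinearMap.mulLeft ℂ (lefschetz b)) (H := weight b) (c := c)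
    (r := finrank ℂ V + 1) (fun x ↦ ?_) (weight_lefschetz_mul b) (weight_dualLefschetz b) ?_ ?_
  · exact dualLefschetz_lefschetz_mul b x
  · rw [weight_of_mem_bidegree b hx, sub_sub, ← Nat.cast_add, hc]
    congr 1
    push_cast
    ring
  · have h := lefschetz_mul_pow_mem_bidegree b hx (finrank ℂ V + 1)
    rwa [bidegree_eq_bot (by omega), Submodule.mem_bot] at h

end HardLefschetz

/-! ### Relations in the Grothendieck ring -/

section Grothendieck

variable {G : Type} [Group G] {U U' U'' : Type} [AddCommGroup U] [Module ℂ U]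
  [FiniteDimensional ℂ U] [AddCommGroup U'] [Module ℂ U'] [FiniteDimensional ℂ U']
  [AddCommGroup U''] [Module ℂ U''] [FiniteDimensional ℂ U'']

theorem GrothendieckRel.mk_eq {p q : MvPolynomial (FDRep ℂ G) ℤ} (h : GrothendieckRel G p q) :
    (Ideal.Quotient.mk _ p : GrothendieckRing G) = Ideal.Quotient.mk _ q :=
  Ideal.Quotient.eq.2 (Ideal.subset_span ⟨p, q, h, rfl⟩)

theorem repClass_exact {ρ' : Representation ℂ G U'} {ρ : Representation ℂ G U}
    {ρ'' : Representation ℂ G U''} (f : IntertwiningMap ρ' ρ) (g : IntertwiningMap ρ ρ'')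
    (hf : Function.Injective f) (hfg : Function.Exact f g) (hg : Function.Surjective g) :
    repClass ρ = repClass ρ' + repClass ρ'' :=
  (GrothendieckRel.exact ρ' ρ ρ'' f g hf hfg hg).mk_eq.trans (map_add _ _ _)

theorem repClass_tprod (ρ : Representation ℂ G U) (ρ' : Representation ℂ G U') :
    repClass (ρ.tprod ρ') = repClass ρ * repClass ρ' :=
  ((map_mul _ _ _).symm.trans (GrothendieckRel.tensor ρ ρ').mk_eq).symm

/-- The sequence `0 → 0 → 0 → 0 → 0` gives `[0] = [0] + [0]`. -/
theorem repClass_trivial_pUnit : repClass (Representation.trivial ℂ G PUnit) = 0 := by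
  have h := repClass_exact (ρ' := Representation.trivial ℂ G PUnit)
    (ρ := Representation.trivial ℂ G PUnit) (ρ'' := Representation.trivial ℂ G PUnit)
    ⟨0, fun g ↦ by simp⟩ ⟨0, fun g ↦ by simp⟩ (Function.injective_of_subsingleton _)
    (fun x ↦ ⟨fun _ ↦ ⟨0, rfl⟩, fun _ ↦ rfl⟩) (fun x ↦ ⟨0, rfl⟩)
  simpa using h

theorem repClass_eq_of_bijective {ρ' : Representation ℂ G U'} {ρ : Representation ℂ G U}
    (f : IntertwiningMap ρ' ρ) (hf : Function.Bijective f) : repClass ρ' = repClass ρ := by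
  have h := repClass_exact (ρ'' := Representation.trivial ℂ G PUnit) f ⟨0, fun g ↦ by simp⟩ hf.1
    (fun x ↦ ⟨fun _ ↦ hf.2 x, fun _ ↦ rfl⟩) (fun x ↦ ⟨0, rfl⟩)
  rw [h, repClass_trivial_pUnit, add_zero]

end Grothendieck

/-! ### The bihomogeneous components as tensor products of exterior powers -/

section TensorProduct

open scoped TensorProduct

/-- The product map from `⋀M ⊗ ⋀N` to `⋀(M × N)` is injective. -/
theorem exteriorAlgebra_mul_injective (M N : Type*) [AddCommGroup M] [Module ℂ M]
    [AddCommGroup N] [Module ℂ N] :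
    Function.Injective (LinearMap.mul' ℂ (ExteriorAlgebra ℂ (M × N)) ∘ₗ TensorProduct.map
      (ExteriorAlgebra.map (LinearMap.inl ℂ M N)).toLinearMap
      (ExteriorAlgebra.map (LinearMap.inr ℂ M N)).toLinearMap) := by
  let Q₁ : QuadraticForm ℂ M := 0
  let Q₂ : QuadraticForm ℂ N := 0
  -- The exterior algebra is the Clifford algebra of the zero form, and a Clifford algebra of an
  -- orthogonal sum is a graded tensor product. The identity of `M × N` is the isometry from the sum
  -- of two zero forms to the zero form.
  let I : QuadraticMap.IsometryEquiv (Q₁.prod Q₂) (0 : QuadraticForm ℂ (M × N)) :=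
    { LinearEquiv.refl ℂ (M × N) with map_app' := fun m ↦ by simp [Q₁, Q₂] }
  let e := (CliffordAlgebra.prodEquiv Q₁ Q₂).symm.trans (CliffordAlgebra.equivOfIsometry I)
  have h₁ : (CliffordAlgebra.map I.toIsometry).comp
      (CliffordAlgebra.map (QuadraticMap.Isometry.inl Q₁ Q₂)) =
      ExteriorAlgebra.map (LinearMap.inl ℂ M N) := by
    refine CliffordAlgebra.hom_ext (LinearMap.ext fun m ↦ ?_)
    change CliffordAlgebra.map _ (CliffordAlgebra.map _ (CliffordAlgebra.ι _ m)) =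
      ExteriorAlgebra.map _ (ExteriorAlgebra.ι ℂ m)
    rw [CliffordAlgebra.map_apply_ι, CliffordAlgebra.map_apply_ι, ExteriorAlgebra.map_apply_ι]
    rfl
  have h₂ : (CliffordAlgebra.map I.toIsometry).comp
      (CliffordAlgebra.map (QuadraticMap.Isometry.inr Q₁ Q₂)) =
      ExteriorAlgebra.map (LinearMap.inr ℂ M N) := by
    refine CliffordAlgebra.hom_ext (LinearMap.ext fun m ↦ ?_)
    change CliffordAlgebra.map _ (CliffordAlgebra.map _ (CliffordAlgebra.ι _ m)) =
      ExteriorAlgebra.map _ (ExteriorAlgebra.ι ℂ m)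
    rw [CliffordAlgebra.map_apply_ι, CliffordAlgebra.map_apply_ι, ExteriorAlgebra.map_apply_ι]
    rfl
  have he : LinearMap.mul' ℂ (ExteriorAlgebra ℂ (M × N)) ∘ₗ TensorProduct.map
      (ExteriorAlgebra.map (LinearMap.inl ℂ M N)).toLinearMap
      (ExteriorAlgebra.map (LinearMap.inr ℂ M N)).toLinearMap =
      e.toLinearMap ∘ₗ (GradedTensorProduct.of ℂ (CliffordAlgebra.evenOdd Q₁)
        (CliffordAlgebra.evenOdd Q₂)).toLinearMap := by
    refine TensorProduct.ext' fun x y ↦ ?_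
    change ExteriorAlgebra.map _ x * ExteriorAlgebra.map _ y = CliffordAlgebra.map I.toIsometry
      (CliffordAlgebra.toProd Q₁ Q₂ (GradedTensorProduct.tmul ℂ x y))
    rw [← h₁, ← h₂, CliffordAlgebra.toProd, GradedTensorProduct.lift_tmul, map_mul]
    rfl
  rw [he]
  exact e.injective.comp (LinearEquiv.injective _)

theorem coe_exteriorPower_map {M N : Type*} [AddCommGroup M] [Module ℂ M] [AddCommGroup N]
    [Module ℂ N] (f : M →ₗ[ℂ] N) (k : ℕ) (x : ⋀[ℂ]^k M) :
    (exteriorPower.map k f x : ExteriorAlgebra ℂ N) = ExteriorAlgebra.map f x := by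
  have h : (⋀[ℂ]^k N).subtype ∘ₗ exteriorPower.map k f =
      (ExteriorAlgebra.map f).toLinearMap ∘ₗ (⋀[ℂ]^k M).subtype := by
    refine exteriorPower.linearMap_ext (AlternatingMap.ext fun v ↦ ?_)
    simp [ExteriorAlgebra.map_apply_ιMulti]
  exact LinearMap.congr_fun h x

variable {V : Type} [AddCommGroup V] [Module ℂ V]

variable (V) in
/-- The product map `⋀^i V ⊗ ⋀^j V* → ⋀(V ⊕ V*)`. -/
def exteriorPowerMul (i j : ℕ) : ⋀[ℂ]^i V ⊗[ℂ] ⋀[ℂ]^j (Dual ℂ V) →ₗ[ℂ] FermionAlgebra V :=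
  (LinearMap.mul' ℂ (FermionAlgebra V) ∘ₗ TensorProduct.map
    (ExteriorAlgebra.map (LinearMap.inl ℂ V (Dual ℂ V))).toLinearMap
    (ExteriorAlgebra.map (LinearMap.inr ℂ V (Dual ℂ V))).toLinearMap) ∘ₗ
    TensorProduct.map (⋀[ℂ]^i V).subtype (⋀[ℂ]^j (Dual ℂ V)).subtype

theorem exteriorPowerMul_tmul (i j : ℕ) (x : ⋀[ℂ]^i V) (y : ⋀[ℂ]^j (Dual ℂ V)) :
    exteriorPowerMul V i j (x ⊗ₜ y) = ExteriorAlgebra.map (LinearMap.inl ℂ V (Dual ℂ V)) x *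
      ExteriorAlgebra.map (LinearMap.inr ℂ V (Dual ℂ V)) y := rfl

theorem exteriorPowerMul_injective (i j : ℕ) : Function.Injective (exteriorPowerMul V i j) :=
  (exteriorAlgebra_mul_injective V (Dual ℂ V)).comp
    (TensorProduct.map_injective_of_flat_flat _ _ (Submodule.subtype_injective _)
      (Submodule.subtype_injective _))

theorem range_exteriorPowerMul (i j : ℕ) :
    LinearMap.range (exteriorPowerMul V i j) = bidegree V i j := by
  have h₁ : Submodule.map (ExteriorAlgebra.map (LinearMap.inl ℂ V (Dual ℂ V))).toLinearMap
      (⋀[ℂ]^i V) = LinearMap.range (ιV V) ^ i := by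
    rw [Submodule.map_pow, ← LinearMap.range_comp, ExteriorAlgebra.map_comp_ι, ιV]
  have h₂ : Submodule.map (ExteriorAlgebra.map (LinearMap.inr ℂ V (Dual ℂ V))).toLinearMap
      (⋀[ℂ]^j (Dual ℂ V)) = LinearMap.range (ιD V) ^ j := by
    rw [Submodule.map_pow, ← LinearMap.range_comp, ExteriorAlgebra.map_comp_ι, ιD]
  change _ = LinearMap.range (ιV V) ^ i * LinearMap.range (ιD V) ^ j
  rw [← h₁, ← h₂]
  apply le_antisymm
  · rintro _ ⟨t, rfl⟩
    induction t using TensorProduct.induction_on with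
    | zero => rw [map_zero]; exact zero_mem _
    | add s t hs ht => rw [map_add]; exact add_mem hs ht
    | tmul x y => exact Submodule.mul_mem_mul ⟨x, x.2, rfl⟩ ⟨y, y.2, rfl⟩
  · rw [Submodule.mul_le]
    rintro _ ⟨x, hx, rfl⟩ _ ⟨y, hy, rfl⟩
    exact ⟨⟨x, hx⟩ ⊗ₜ ⟨y, hy⟩, rfl⟩

variable {G : Type} [Group G] (ρ : Representation ℂ G V)

theorem fermionMap_exteriorPowerMul (g : G) (i j : ℕ)
    (t : ⋀[ℂ]^i V ⊗[ℂ] ⋀[ℂ]^j (Dual ℂ V)) :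
    exteriorPowerMul V i j ((exteriorPowerRep ρ i).tprod (exteriorPowerRep ρ.dual j) g t) =
      fermionMap ρ g (exteriorPowerMul V i j t) := by
  induction t using TensorProduct.induction_on with
  | zero => simp
  | add s t hs ht => rw [map_add, map_add, hs, ht, map_add, map_add]
  | tmul x y =>
    rw [Representation.tprod_apply, TensorProduct.map_tmul, exteriorPowerMul_tmul,
      exteriorPowerMul_tmul, map_mul]
    have h₁ : (ExteriorAlgebra.map (LinearMap.inl ℂ V (Dual ℂ V))).comp
        (ExteriorAlgebra.map (ρ g)) = (fermionMap ρ g).comp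
          (ExteriorAlgebra.map (LinearMap.inl ℂ V (Dual ℂ V))) := by
      rw [fermionMap, ExteriorAlgebra.map_comp_map, ExteriorAlgebra.map_comp_map]
      congr 1
    have h₂ : (ExteriorAlgebra.map (LinearMap.inr ℂ V (Dual ℂ V))).comp
        (ExteriorAlgebra.map (ρ.dual g)) = (fermionMap ρ g).comp
          (ExteriorAlgebra.map (LinearMap.inr ℂ V (Dual ℂ V))) := by
      rw [fermionMap, ExteriorAlgebra.map_comp_map, ExteriorAlgebra.map_comp_map]
      congr 1
      refine LinearMap.ext fun f ↦ ?_
      simp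
    have e₁ : ((exteriorPowerRep ρ i g x : ⋀[ℂ]^i V) : ExteriorAlgebra ℂ V) =
      ExteriorAlgebra.map (ρ g) x := coe_exteriorPower_map _ _ _
    have e₂ : ((exteriorPowerRep ρ.dual j g y : ⋀[ℂ]^j (Dual ℂ V)) : ExteriorAlgebra ℂ (Dual ℂ V)) =
      ExteriorAlgebra.map (ρ.dual g) y := coe_exteriorPower_map _ _ _
    rw [e₁, e₂]
    exact congrArg₂ _ (DFunLike.congr_fun h₁ (x : ExteriorAlgebra ℂ V))
      (DFunLike.congr_fun h₂ (y : ExteriorAlgebra ℂ (Dual ℂ V)))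

/-- The action of `G` on `⋀(V ⊕ V*)`. -/
def fermionRep : Representation ℂ G (FermionAlgebra V) where
  toFun g := (fermionMap ρ g).toLinearMap
  map_one' := by
    rw [fermionMap, map_one]
    exact congrArg AlgHom.toLinearMap ExteriorAlgebra.map_id
  map_mul' g h := by
    rw [fermionMap, map_mul]
    exact congrArg AlgHom.toLinearMap (ExteriorAlgebra.map_comp_map _ _).symm

/-- The action of `G` on a bihomogeneous component of `⋀(V ⊕ V*)`. -/
def bidegreeRep (i j : ℕ) : Representation ℂ G (bidegree V i j) :=
  (fermionRep ρ).subrepresentation (bidegree V i j) fun g x hx ↦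
    bidegree_map_le ρ i j g ⟨x, hx, rfl⟩

instance [FiniteDimensional ℂ V] (i j : ℕ) : FiniteDimensional ℂ (bidegree V i j) := by
  rw [← range_exteriorPowerMul]
  infer_instance

theorem repClass_bidegreeRep [FiniteDimensional ℂ V] (i j : ℕ) :
    repClass (bidegreeRep ρ i j) =
      repClass (exteriorPowerRep ρ i) * repClass (exteriorPowerRep ρ.dual j) := by
  rw [← repClass_tprod]
  let f : IntertwiningMap ((exteriorPowerRep ρ i).tprod (exteriorPowerRep ρ.dual j))
      (bidegreeRep ρ i j) :=
    ⟨(exteriorPowerMul V i j).codRestrict (bidegree V i j) fun t ↦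
      range_exteriorPowerMul (V := V) i j ▸ LinearMap.mem_range_self _ t,
      fun g ↦ LinearMap.ext fun t ↦ Subtype.ext (fermionMap_exteriorPowerMul ρ g i j t)⟩
  refine (repClass_eq_of_bijective f ⟨fun s t hst ↦ ?_, fun ⟨x, hx⟩ ↦ ?_⟩).symm
  · exact exteriorPowerMul_injective i j (congrArg Subtype.val hst)
  · rw [← range_exteriorPowerMul] at hx
    obtain ⟨t, rfl⟩ := hx
    exact ⟨t, rfl⟩

end TensorProduct

/-! ### The bihomogeneous components of the coinvariant ring -/

section Coinvariants

variable {V : Type} [AddCommGroup V] [Module ℂ V] {κ : Type} [Fintype κ] (b : Basis κ ℂ V)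
  {G : Type} [Group G] (ρ : Representation ℂ G V)

/-- The projection of a bihomogeneous component of `⋀(V ⊕ V*)` to that of the coinvariant ring. -/
def bidegreeToDR (i j : ℕ) : IntertwiningMap (bidegreeRep ρ i j) (DRBidegreeRep ρ i j) :=
  ⟨(Ideal.Quotient.mkₐ ℂ (coinvariantIdeal ρ)).toLinearMap.restrict fun x hx ↦ ⟨x, hx, rfl⟩,
    fun _ ↦ rfl⟩

theorem bidegreeToDR_surjective (i j : ℕ) : Function.Surjective (bidegreeToDR ρ i j) := by
  rintro ⟨_, ⟨x, hx, rfl⟩⟩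
  exact ⟨⟨x, hx⟩, rfl⟩

theorem bidegreeToDR_eq_zero_iff {i j : ℕ} (x : bidegree V i j) :
    bidegreeToDR ρ i j x = 0 ↔ (x : FermionAlgebra V) ∈ coinvariantIdeal ρ :=
  Subtype.ext_iff.trans Ideal.Quotient.eq_zero_iff_mem

/-- The multiplication by the Lefschetz element on a bihomogeneous component. -/
def bidegreeLefschetz (i j : ℕ) :
    IntertwiningMap (bidegreeRep ρ i j) (bidegreeRep ρ (i + 1) (j + 1)) :=
  ⟨(LinearMap.mulLeft ℂ (lefschetz b)).restrict fun _ hx ↦ lefschetz_mul_mem_bidegree b hx,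
    fun g ↦ LinearMap.ext fun x ↦ Subtype.ext <| by
      change lefschetz b * fermionMap ρ g x = fermionMap ρ g (lefschetz b * x)
      rw [map_mul, fermionMap_lefschetz]⟩

variable [FiniteDimensional ℂ V]

theorem bidegreeProj_lefschetz_mul (i j : ℕ) (y : FermionAlgebra V) :
    bidegreeProj (i + 1, j + 1) (lefschetz b * y) = lefschetz b * bidegreeProj (i, j) y := by
  refine bidegreeProj_map (f := LinearMap.mulLeft ℂ (lefschetz b))
    (σ := fun p ↦ (p.1 + 1, p.2 + 1)) ?_ (fun p x hx ↦ ?_) (i, j) y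
  · rintro ⟨i, j⟩ ⟨k, l⟩ h
    rw [Prod.ext_iff] at h ⊢
    exact ⟨Nat.succ_injective h.1, Nat.succ_injective h.2⟩
  · rw [LinearMap.mulLeft_apply]
    exact lefschetz_mul_mem_bidegree b hx

theorem bidegreeProj_lefschetz_mul_eq_zero {i j : ℕ} (hij : i = 0 ∨ j = 0)
    (y : FermionAlgebra V) : bidegreeProj (i, j) (lefschetz b * y) = 0 := by
  refine bidegreeProj_map_eq_zero (f := LinearMap.mulLeft ℂ (lefschetz b))
    (σ := fun p ↦ (p.1 + 1, p.2 + 1)) (fun p x hx ↦ ?_) (q := (i, j)) (fun p h ↦ ?_) y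
  · rw [LinearMap.mulLeft_apply]
    exact lefschetz_mul_mem_bidegree b hx
  · rw [Prod.ext_iff] at h
    rcases hij with rfl | rfl
    · exact Nat.succ_ne_zero _ h.1
    · exact Nat.succ_ne_zero _ h.2

/-- The short exact sequence is multiplication by the canonical element followed by the projection
to the coinvariant ring; hard Lefschetz gives injectivity. -/
theorem repClass_DRBidegreeRep_succ_succ
    (hρ : ∀ x, (∀ g, fermionMap ρ g x = x) → ∀ a α, rankOneAction a α x = 0) {i j : ℕ}
    (hij : i + j < finrank ℂ V) :
    repClass (bidegreeRep ρ (i + 1) (j + 1)) =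
      repClass (bidegreeRep ρ i j) + repClass (DRBidegreeRep ρ (i + 1) (j + 1)) := by
  obtain ⟨b⟩ : Nonempty (Basis (Fin (finrank ℂ V)) ℂ V) := ⟨finBasis ℂ V⟩
  refine repClass_exact (bidegreeLefschetz b ρ i j) (bidegreeToDR ρ (i + 1) (j + 1)) ?_ ?_
    (bidegreeToDR_surjective ρ _ _)
  · refine (injective_iff_map_eq_zero _).2 fun x hx ↦ Subtype.ext ?_
    exact lefschetz_injective b (by simpa using hij) x.2 (congrArg Subtype.val hx)
  · intro x
    rw [bidegreeToDR_eq_zero_iff, mem_coinvariantIdeal_iff b ρ hρ]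
    constructor
    · rintro ⟨y, hy⟩
      -- The preimage `y` need not be homogeneous. Multiplication by the canonical element shifts
      -- bidegrees, so only the component of `y` of bidegree `(i, j)` contributes.
      refine ⟨⟨bidegreeProj (i, j) y, bidegreeProj_mem (i, j) y⟩, Subtype.ext ?_⟩
      have h := bidegreeProj_lefschetz_mul b i j y
      rw [hy, bidegreeProj_of_mem (p := (i + 1, j + 1)) x.2] at h
      exact h.symm
    · rintro ⟨y, rfl⟩
      exact ⟨y, rfl⟩

/-- Multiples of the canonical element have both degrees positive, so the ideal does not meet these
components. -/
theorem repClass_DRBidegreeRep_of_eq_zero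
    (hρ : ∀ x, (∀ g, fermionMap ρ g x = x) → ∀ a α, rankOneAction a α x = 0) {i j : ℕ}
    (hij : i = 0 ∨ j = 0) : repClass (bidegreeRep ρ i j) = repClass (DRBidegreeRep ρ i j) := by
  obtain ⟨b⟩ : Nonempty (Basis (Fin (finrank ℂ V)) ℂ V) := ⟨finBasis ℂ V⟩
  refine repClass_eq_of_bijective (bidegreeToDR ρ i j)
    ⟨(injective_iff_map_eq_zero _).2 fun x hx ↦ Subtype.ext ?_, bidegreeToDR_surjective ρ i j⟩
  rw [bidegreeToDR_eq_zero_iff, mem_coinvariantIdeal_iff b ρ hρ] at hx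
  obtain ⟨y, hy⟩ := hx
  have h := bidegreeProj_lefschetz_mul_eq_zero b hij y
  rwa [hy, bidegreeProj_of_mem (p := (i, j)) x.2] at h

theorem DRBidegree_eq_bot
    (hρ : ∀ x, (∀ g, fermionMap ρ g x = x) → ∀ a α, rankOneAction a α x = 0) {i j : ℕ}
    (hij : finrank ℂ V < i + j) : DRBidegree ρ i j = ⊥ := by
  rw [eq_bot_iff]
  rintro _ ⟨x, hx, rfl⟩
  obtain ⟨b⟩ : Nonempty (Basis (Fin (finrank ℂ V)) ℂ V) := ⟨finBasis ℂ V⟩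
  exact Ideal.Quotient.eq_zero_iff_mem.2 ((mem_coinvariantIdeal_iff b ρ hρ).2
    (lefschetz_surjective b (by simpa using hij) hx))

theorem repClass_DRBidegreeRep
    (hρ : ∀ x, (∀ g, fermionMap ρ g x = x) → ∀ a α, rankOneAction a α x = 0) {i j : ℕ}
    (hij : i + j ≤ finrank ℂ V) :
    repClass (DRBidegreeRep ρ i j) = exteriorPowerClass ρ i * exteriorPowerClass ρ.dual j -
      exteriorPowerClass ρ (i - 1) * exteriorPowerClass ρ.dual (j - 1) := by
  have hcast (k : ℕ) : ((k + 1 : ℕ) : ℤ) - 1 = (k : ℕ) := by simp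
  have hneg : ((0 : ℕ) : ℤ) - 1 = Int.negSucc 0 := rfl
  have hclass {U : Type} [AddCommGroup U] [Module ℂ U] [FiniteDimensional ℂ U]
      (σ : Representation ℂ G U) (k : ℕ) :
      exteriorPowerClass σ (k : ℤ) = repClass (exteriorPowerRep σ k) := rfl
  have hclass0 {U : Type} [AddCommGroup U] [Module ℂ U] [FiniteDimensional ℂ U]
      (σ : Representation ℂ G U) : exteriorPowerClass σ (Int.negSucc 0) = 0 := rfl
  -- If `i` or `j` is zero, the subtracted product has a factor of index `-1` and vanishes.
  -- Otherwise both indices shift down by one and the exact sequence applies.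
  rcases i with - | i
  · rw [hneg, hclass0, zero_mul, sub_zero, hclass, hclass, ← repClass_bidegreeRep,
      repClass_DRBidegreeRep_of_eq_zero ρ hρ (.inl rfl)]
  rcases j with - | j
  · rw [hneg, hclass0, mul_zero, sub_zero, hclass, hclass, ← repClass_bidegreeRep,
      repClass_DRBidegreeRep_of_eq_zero ρ hρ (.inr rfl)]
  rw [hcast, hcast, hclass, hclass, hclass, hclass, ← repClass_bidegreeRep,
    ← repClass_bidegreeRep, repClass_DRBidegreeRep_succ_succ ρ hρ (by omega), add_sub_cancel_left]

end Coinvariants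

end FermionicCoinvariants

end

open FermionicCoinvariants in
theorem theorem4p3 (V : Type) [AddCommGroup V] [Module ℂ V] [FiniteDimensional ℂ V] (n : ℕ)
    (hn : Module.finrank ℂ V = n) (W : Subgroup (LinearMap.GeneralLinearGroup ℂ V))
    (hW : IsComplexReflectionGroup W) (hirr : IsIrreducibleReflectionGroup W)
    (hne : n = 1 → W ≠ ⊥) (i j : ℕ) :
    (n < i + j → DRBidegree (reflectionRep W) i j = ⊥) ∧
    (i + j ≤ n →
      repClass (DRBidegreeRep (reflectionRep W) i j) =
        exteriorPowerClass (reflectionRep W) i * exteriorPowerClass (reflectionRep W).dual j -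
          exteriorPowerClass (reflectionRep W) (i - 1) *
            exteriorPowerClass (reflectionRep W).dual (j - 1)) := by
  subst hn
  have hρ (x : FermionAlgebra V) (hx : ∀ g, fermionMap (reflectionRep W) g x = x) (a : V)
      (α : Module.Dual ℂ V) : rankOneAction a α x = 0 :=
    rankOneAction_eq_zero_of_invariant hW hirr hne hx a α
  exact ⟨DRBidegree_eq_bot _ hρ, repClass_DRBidegreeRep _ hρ⟩
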